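/- Let $n\ge 1$, $m\ge 0$ be integers, $0\le p<1$, and for $i=1,\dots,n$ let $\mathcal D_i$ be a probability distribution and $F_i(x;\xi)$ a real loss function of $x\in\mathbb R^{nm}$ and a data point $\xi$, jointly measurable, differentiable in $x$, and $\mathcal D_i$-integrable in $\xi$. Put $f_i(x)=\mathbb E_{\xi\sim\mathcal D_i}F_i(x;\xi)$ and $f=\frac1n\sum_{i=1}^n f_i$, and assume that each $f_i$ is differentiable and that $f^*=\inf f>-\infty$. Vectors in $\mathbb R^{nm}$ are divided into $n$ blocks of size $m$; write $v^{(i,j)}$ for the $j$-th block of a vector $v^{(i)}$. **Algorithm (RPS).** All workers $i=1,\dots,n$ start from $x_1^{(i)}=0$. In iteration $t=1,2,\dots$, worker $i$ draws $\xi_t^{(i)}\sim\mathcal D_i$ and computes $v_t^{(i)}=x_t^{(i)}-\gamma\nabla F_i(x_t^{(i)};\xi_t^{(i)})$, where $\gamma>0$ is the step size. A uniformly random permutation $b_t$ of the workers is drawn; worker $b_t^{(j)}$ is in charge of block $j$. *Reduce-Scatter:* every worker sends its $j$-th block to worker $b_t^{(j)}$, which computes the average $\tilde v_t^{(j)}$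 of the $j$-th blocks of the workers in $\mathcal N_t^{(j)}$, the set that consists of $b_t^{(j)}$ itself and of all workers whose message was not dropped. *All-Gather:* worker $b_t^{(j)}$ sends $\tilde v_t^{(j)}$ to all workers. If $i=b_t^{(j)}$ or the message to worker $i$ was not dropped, then $x_{t+1}^{(i,j)}=\tilde v_t^{(j)}$; otherwise $x_{t+1}^{(i,j)}=v_t^{(i,j)}$. Each message between two different workers is dropped with probability $p$; all samples, permutations and drops, over all iterations, are independent. **Constants.** Let $W_t^{(j)}\in\mathbb R^{n\times n}$ be the random matrix of coefficients with $x_{t+1}^{(c,j)}=\sum_{a=1}^n [W_t^{(j)}]_{a,c}\,v_t^{(a,j)}$ for all $c$, and let $A_n$ be the $n\times n$ matrix with all entries $1/n$. There are constants $0\le\alpha_2\le\alpha_1<1$ (unique if $n\ge2$), depending only on $n$ and $p$, such that for all $j$ and $t$ $$\mathbb E\big[W_t^{(j)}(W_t^{(j)})^\top\big]=\alpha_1I_n+(1-\alpha_1)A_n,\qquad \mathbb E\big[W_t^{(j)}A_n(W_t^{(j)})^\top\big]=\alpha_2I_n+(1-\alpha_2)A_n .$$ For any such constants put $\beta=\alpha_1-\alpha_2$.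 **Theorem.** Assume that for some $L\ge0$ and real $\sigma,\zeta$, for all $i$, $x$, $y$, $$\|\nabla f_i(x)-\nabla f_i(y)\|\le L\|x-y\|,\qquad \mathbb E_{\xi\sim\mathcal D_i}\|\nabla F_i(x;\xi)-\nabla f_i(x)\|^2\le\sigma^2,\qquad \frac1n\sum_{i=1}^n\|\nabla f_i(x)-\nabla f(x)\|^2\le\zeta^2 ,$$ and that $1-\frac{6L^2\gamma^2}{(1-\sqrt\beta)^2}>0$. Then for every $T\ge1$ the expectations below are finite and $$\begin{aligned}\frac1T\sum_{t=1}^T\Big(\mathbb E\|\nabla f(\overline x_t)\|^2+(1-L\gamma)\,\mathbb E\|\overline\nabla f(X_t)\|^2\Big)\le{}&\frac{2f(0)-2f^*}{\gamma T}+\frac{\gamma L\sigma^2}{n}+4\alpha_2L\gamma(\sigma^2+3\zeta^2)\\&+\frac{(2\alpha_2L\gamma+L^2\gamma^2+12\alpha_2L^3\gamma^3)\sigma^2C_1}{(1-\sqrt\beta)^2}\\&+\frac{3(2\alpha_2L\gamma+L^2\gamma^2+12\alpha_2L^3\gamma^3)\zeta^2C_1}{(1-\sqrt\beta)^2},\end{aligned}$$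 where $\overline x_t=\frac1n\sum_{i=1}^n x_t^{(i)}$, $\overline\nabla f(X_t)=\frac1n\sum_{i=1}^n\nabla f_i(x_t^{(i)})$ and $C_1=\Big(1-\frac{6L^2\gamma^2}{(1-\sqrt\beta)^2}\Big)^{-1}$. -/

import Mathlib

open MeasureTheory ProbabilityTheory

noncomputable section

namespace RPS

/-! ### Models and local losses -/

/-- Models: vectors in `ℝ^(n*m)` with the Euclidean norm, divided into `n` blocks of size `m`.
The coordinate `(j, k)` is the `k`-th entry of the `j`-th block. -/
abbrev Model (n m : ℕ) : Type := EuclideanSpace ℝ (Fin n × Fin m)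

/-- The average of the `n` local models (or local vectors). -/
def average {n m : ℕ} (x : Fin n → Model n m) : Model n m := (1 / (n : ℝ)) • ∑ i, x i

section Losses

variable {n m : ℕ} {Ξ : Fin n → Type*} [∀ i, MeasurableSpace (Ξ i)]

/-- `f_i(x) = E_{ξ ∼ D_i} F_i(x; ξ)`. -/
def localLoss (D : ∀ i, Measure (Ξ i)) (F : ∀ i, Model n m → Ξ i → ℝ) (i : Fin n)
    (x : Model n m) : ℝ :=
  ∫ ξ, F i x ξ ∂(D i)

/-- `f(x) = (1/n) ∑ i, f_i(x)`. -/
def globalLoss (D : ∀ i, Measure (Ξ i)) (F : ∀ i, Model n m → Ξ i → ℝ) (x : Model n m) : ℝ :=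
  (1 / (n : ℝ)) * ∑ i, localLoss D F i x

/-- The average of the local gradients, each at the worker's own model:
`(1/n) ∑ i, ∇ f_i (x i)`. -/
def averageGradient (D : ∀ i, Measure (Ξ i)) (F : ∀ i, Model n m → Ξ i → ℝ)
    (x : Fin n → Model n m) : Model n m :=
  average fun i => gradient (localLoss D F i) (x i)

/-- The stochastic gradient `∇ F_i (x; ξ)`, the gradient being taken in `x`. -/
def stochGradient (F : ∀ i, Model n m → Ξ i → ℝ) (i : Fin n) (x : Model n m) (ξ : Ξ i) :
    Model n m :=
  gradient (fun y => F i y ξ) x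

end Losses

/-! ### The unreliable network during one iteration -/

instance permMeasurableSpace (n : ℕ) : MeasurableSpace (Equiv.Perm (Fin n)) := ⊤

/-- The network randomness of one iteration.
* First component: the assignment `b` of blocks to workers (block `j` is averaged by worker `b j`).
* Second component, at `(i, j)`: is the message that carries block `j` of worker `i` to worker `b j`
  dropped (Reduce-Scatter)?
* Third component, at `(j, i)`: is the message that carries the averaged block `j` from worker `b j`
  to worker `i` dropped (All-Gather)?

The entries with `i = b j` belong to no message and are ignored below. -/
abbrev Net (n : ℕ) : Type :=
  Equiv.Perm (Fin n) × (Fin n × Fin n → Bool) × (Fin n × Fin n → Bool)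

/-- The law of the network randomness: a uniformly random assignment, and, independently of it,
independent drops, each with probability `p`. -/
def netLaw (n : ℕ) (p : unitInterval) : Measure (Net n) :=
  (PMF.uniformOfFintype (Equiv.Perm (Fin n))).toMeasure.prod
    ((Measure.pi fun _ : Fin n × Fin n => bernoulliMeasure true false p).prod
      (Measure.pi fun _ : Fin n × Fin n => bernoulliMeasure true false p))

section Network

variable {n m : ℕ}

/-- The worker that averages block `j`. -/
def owner (s : Net n) (j : Fin n) : Fin n := s.1 j

/-- The workers whose `j`-th block reaches the worker that averages block `j`. That worker always
has its own block. -/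
def received (s : Net n) (j : Fin n) : Finset (Fin n) :=
  Finset.univ.filter fun i => i = owner s j ∨ s.2.1 (i, j) = false

/-- Worker `i` obtains the averaged block `j`. The worker that computed it always does. -/
def Gets (s : Net n) (i j : Fin n) : Prop := i = owner s j ∨ s.2.2 (j, i) = false

instance (s : Net n) (i j : Fin n) : Decidable (Gets s i j) := by
  unfold Gets; infer_instance

/-- The averaged block `j`. -/
def blockAverage (s : Net n) (v : Fin n → Model n m) (j : Fin n) (k : Fin m) : ℝ :=
  (1 / ((received s j).card : ℝ)) * ∑ i ∈ received s j, v i (j, k)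

/-- Reduce-Scatter followed by All-Gather: worker `i` replaces its `j`-th block by the averaged
block `j` if it obtains it, and keeps its own block otherwise. -/
def communicate (s : Net n) (v : Fin n → Model n m) (i : Fin n) : Model n m :=
  WithLp.toLp 2 fun jk =>
    if Gets s i jk.1 then blockAverage s v jk.1 jk.2 else v i jk

/-- The coefficient matrix `W^(j)`: after the communication, the `j`-th block of worker `c` is
`∑ a, W^(j) a c • (j-th block of worker a)`. -/
def mixing (s : Net n) (j : Fin n) : Matrix (Fin n) (Fin n) ℝ :=
  Matrix.of fun a c =>
    if Gets s c j then (if a ∈ received s j then 1 / ((received s j).card : ℝ) else 0)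
    else (if a = c then 1 else 0)

theorem communicate_eq_mixing (s : Net n) (v : Fin n → Model n m) (c j : Fin n) (k : Fin m) :
    communicate s v c (j, k) = ∑ a, v a (j, k) * mixing s j a c := by
  by_cases h : Gets s c j
  · simp [communicate, mixing, blockAverage, h, Finset.mul_sum, mul_comm]
  · simp [communicate, mixing, h]

end Network

/-- The matrix `A_n`, all of whose entries are `1/n`. -/
def avgMatrix (n : ℕ) : Matrix (Fin n) (Fin n) ℝ := Matrix.of fun _ _ => 1 / (n : ℝ)

/-- The entrywise expectation of a random matrix that depends on the network randomness. -/
def netExpect {n : ℕ} (p : unitInterval) (M : Net n → Matrix (Fin n) (Fin n) ℝ) :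
    Matrix (Fin n) (Fin n) ℝ :=
  Matrix.of fun a c => ∫ s, M s a c ∂(netLaw n p)

/-- `α₁`, `α₂` are the constants of the second moments of the mixing matrices: for all blocks `j`,
`E[W Wᵀ] = α₁ I + (1 - α₁) A_n` and `E[W A_n Wᵀ] = α₂ I + (1 - α₂) A_n`,
where `0 ≤ α₂ ≤ α₁ < 1`. (For `n ≥ 2` each of the two equations determines its constant; for
`n = 1` they are void and only the inequalities matter.) -/
structure IsMixingPair (n : ℕ) (p : unitInterval) (α₁ α₂ : ℝ) : Prop where
  nonneg : 0 ≤ α₂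
  le : α₂ ≤ α₁
  lt_one : α₁ < 1
  second_moment : ∀ j : Fin n,
    netExpect p (fun s => mixing s j * (mixing s j).transpose)
      = α₁ • (1 : Matrix (Fin n) (Fin n) ℝ) + (1 - α₁) • avgMatrix n
  averaged_second_moment : ∀ j : Fin n,
    netExpect p (fun s => mixing s j * avgMatrix n * (mixing s j).transpose)
      = α₂ • (1 : Matrix (Fin n) (Fin n) ℝ) + (1 - α₂) • avgMatrix n

/-! ### The algorithm -/

section Algorithm

variable {n m : ℕ} {Ξ : Fin n → Type*} [∀ i, MeasurableSpace (Ξ i)]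

/-- The law of the randomness of one iteration: the samples `ξ i ∼ D i` of the workers and the
network randomness, all independent. -/
def roundLaw (D : ∀ i, Measure (Ξ i)) (p : unitInterval) : Measure ((∀ i, Ξ i) × Net n) :=
  (Measure.pi D).prod (netLaw n p)

/-- `Y 0, Y 1, …` are independent random variables on `(Ω, P)` with the common law `μ`. -/
structure IsIIDSample {Ω S : Type*} [MeasurableSpace Ω] [MeasurableSpace S] (P : Measure Ω)
    (μ : Measure S) (Y : ℕ → Ω → S) : Prop where
  measurable : ∀ t, Measurable (Y t)
  indep : iIndepFun Y P
  law : ∀ t, P.map (Y t) = μ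

/-- One iteration: every worker makes a stochastic gradient step with step size `γ` on its own
model, then the models are communicated. -/
def step (F : ∀ i, Model n m → Ξ i → ℝ) (γ : ℝ) (x : Fin n → Model n m)
    (y : (∀ i, Ξ i) × Net n) : Fin n → Model n m :=
  communicate y.2 fun i => x i - γ • stochGradient F i (x i) (y.1 i)

/-- The local models before the iteration number `t`, where the iterations are numbered from `0`
and all models start at the origin; `y t` is the randomness of the iteration number `t`. -/
def iterate (F : ∀ i, Model n m → Ξ i → ℝ) (γ : ℝ) (y : ℕ → (∀ i, Ξ i) × Net n) :
    ℕ → Fin n → Model n m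
  | 0 => fun _ => 0
  | t + 1 => step F γ (iterate F γ y t) (y t)

end Algorithm

end RPS

end

noncomputable section

namespace RPS

/-! ### The law of the network randomness -/

/-! The argument follows two quantities: the loss at the average model and the deviation, the sum of
squared distances of the local models from their average. Communication acts on both only through
the second moments of the mixing matrices. Applied to each coordinate, the two moment identities
show that a communication round multiplies the expected deviation by exactly `α₁ - α₂`
(`IsMixingPair.integral_deviation_communicate`), leaves the average unbiased, and gives it an extra
mean square error of `α₂ / n` times the deviation
(`IsMixingPair.integral_norm_sq_average_communicate_sub`). The constants exist because the law of
the network is invariant under renaming workers and blocks: an invariant matrix is a combination of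
the identity and the averaging matrix, and traces order the coefficients (`exists_isMixingPair`).

With `q = √β`, Young's inequality with weights `q` and `1 - q` separates the old deviation from that
of the stochastic gradients, which is controlled by `σ`, `ζ` and the old deviation itself. The
resulting contraction (`integral_deviation_step_le`) starts from zero and sums to a bound on the
total deviation; the step size condition is what allows the deviation on the right to be absorbed
(`sum_le_of_contraction`).

For the loss, the descent inequality at the average model and the polarization of the inner product
between `∇f` at the average and the averaged local gradients yield the two squared norms of the
theorem, with errors from gradient noise, communication and deviation
(`integral_globalLoss_step_le`). These telescope (`average_le_of_descent`), and the deviation bound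
is inserted.

Unbiasedness of the stochastic gradients is not a hypothesis. It follows from bounded variance:
difference quotients of the losses have uniformly bounded second moments, so limit and expectation
commute (`integral_gradient_eq`). One-step bounds hold for every fixed family of models and pass to
the trajectory by Fubini, since the models before an iteration are independent of its randomness. -/

instance netLaw_isProbabilityMeasure (n : ℕ) (p : unitInterval) :
    IsProbabilityMeasure (netLaw n p) := by
  unfold netLaw; infer_instance

theorem integrable_netLaw {n : ℕ} (p : unitInterval) {E : Type*} [NormedAddCommGroup E]
    (f : Net n → E) : Integrable f (netLaw n p) :=
  Integrable.of_finite

theorem integral_netLaw {n : ℕ} (p : unitInterval) (f : Net n → ℝ) :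
    ∫ s, f s ∂(netLaw n p) = ∑ s, (netLaw n p).real {s} * f s := by
  rw [integral_fintype (integrable_netLaw p f)]
  rfl

theorem sum_netLaw {n : ℕ} (p : unitInterval) : ∑ s, (netLaw n p).real {s} = 1 := by
  simp

theorem netLaw_real_singleton {n : ℕ} (p : unitInterval) (s : Net n) :
    (netLaw n p).real {s} = (Fintype.card (Equiv.Perm (Fin n)) : ℝ)⁻¹ *
      ((∏ i, (bernoulliMeasure true false p).real {s.2.1 i}) *
        ∏ i, (bernoulliMeasure true false p).real {s.2.2 i}) := by
  obtain ⟨b, d, e⟩ := s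
  have h : ({(b, d, e)} : Set (Net n)) = {b} ×ˢ ({d} ×ˢ {e}) := by simp
  rw [h, netLaw, measureReal_prod_prod, measureReal_prod_prod]
  congr 1
  · rw [measureReal_def, PMF.toMeasure_apply_singleton _ _ (measurableSet_singleton _),
      PMF.uniformOfFintype_apply]
    simp
  · simp [measureReal_def, Measure.pi_singleton, ENNReal.toReal_prod]

/-- The lossless outcome has positive probability; this is where `p < 1` enters, and it makes `α₁ <
1` strict. -/
theorem netLaw_real_singleton_pos {n : ℕ} {p : unitInterval} (hp : (p : ℝ) < 1) :
    0 < (netLaw n p).real {((1 : Equiv.Perm (Fin n)), (fun _ => false), (fun _ => false))} := by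
  have h : 0 < (bernoulliMeasure true false p).real {false} := by
    rw [bernoulliMeasure_real_apply_of_notMem_of_mem p (measurableSet_singleton _)
      (by simp) (by simp)]
    simpa using hp
  rw [netLaw_real_singleton]
  have hc : (0 : ℝ) < Fintype.card (Equiv.Perm (Fin n)) := by
    exact_mod_cast Fintype.card_pos
  have := Finset.prod_pos (s := (Finset.univ : Finset (Fin n × Fin n)))
    (f := fun _ => (bernoulliMeasure true false p).real {false}) (fun _ _ => h)
  positivity

/-- Renaming the workers. -/
def relabel {n : ℕ} (π : Equiv.Perm (Fin n)) : Net n ≃ Net n :=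
  Equiv.prodCongr (Equiv.mulLeft π)
    (Equiv.prodCongr
      (Equiv.arrowCongr (Equiv.prodCongr π (Equiv.refl _)) (Equiv.refl _))
      (Equiv.arrowCongr (Equiv.prodCongr (Equiv.refl _) π) (Equiv.refl _)))

theorem netLaw_real_relabel {n : ℕ} (p : unitInterval) (π : Equiv.Perm (Fin n)) (s : Net n) :
    (netLaw n p).real {relabel π s} = (netLaw n p).real {s} := by
  rw [netLaw_real_singleton, netLaw_real_singleton]
  congr 2
  · exact Equiv.prod_comp (Equiv.prodCongr π (Equiv.refl _)).symm
      (fun i => (bernoulliMeasure true false p).real {s.2.1 i})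
  · exact Equiv.prod_comp (Equiv.prodCongr (Equiv.refl _) π).symm
      (fun i => (bernoulliMeasure true false p).real {s.2.2 i})

theorem integral_netLaw_relabel {n : ℕ} (p : unitInterval) (π : Equiv.Perm (Fin n))
    (f : Net n → ℝ) : ∫ s, f (relabel π s) ∂(netLaw n p) = ∫ s, f s ∂(netLaw n p) := by
  rw [integral_netLaw, integral_netLaw,
    ← Equiv.sum_comp (relabel π) fun s => (netLaw n p).real {s} * f s]
  simp_rw [netLaw_real_relabel]

theorem gets_relabel {n : ℕ} (π : Equiv.Perm (Fin n)) (s : Net n) (c j : Fin n) :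
    Gets (relabel π s) (π c) j ↔ Gets s c j := by
  simp [Gets, relabel, owner]

theorem mem_received_relabel {n : ℕ} (π : Equiv.Perm (Fin n)) (s : Net n) (a j : Fin n) :
    π a ∈ received (relabel π s) j ↔ a ∈ received s j := by
  simp only [received, Finset.mem_filter, Finset.mem_univ, true_and]
  simp [relabel, owner]

theorem card_received_relabel {n : ℕ} (π : Equiv.Perm (Fin n)) (s : Net n) (j : Fin n) :
    (received (relabel π s) j).card = (received s j).card := by
  refine (Finset.card_equiv π fun a => ?_).symm
  exact (mem_received_relabel π s a j).symm

theorem mixing_relabel {n : ℕ} (π : Equiv.Perm (Fin n)) (s : Net n) (j a c : Fin n) :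
    mixing (relabel π s) j (π a) (π c) = mixing s j a c := by
  simp [mixing, gets_relabel, mem_received_relabel, card_received_relabel]

/-- Renaming the blocks. -/
def relabelBlocks {n : ℕ} (ρ : Equiv.Perm (Fin n)) : Net n ≃ Net n :=
  Equiv.prodCongr (Equiv.mulRight ρ)
    (Equiv.prodCongr
      (Equiv.arrowCongr (Equiv.prodCongr (Equiv.refl _) ρ.symm) (Equiv.refl _))
      (Equiv.arrowCongr (Equiv.prodCongr ρ.symm (Equiv.refl _)) (Equiv.refl _)))

theorem netLaw_real_relabelBlocks {n : ℕ} (p : unitInterval) (ρ : Equiv.Perm (Fin n))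
    (s : Net n) : (netLaw n p).real {relabelBlocks ρ s} = (netLaw n p).real {s} := by
  rw [netLaw_real_singleton, netLaw_real_singleton]
  congr 2
  · exact Equiv.prod_comp (Equiv.prodCongr (Equiv.refl _) ρ)
      (fun i => (bernoulliMeasure true false p).real {s.2.1 i})
  · exact Equiv.prod_comp (Equiv.prodCongr ρ (Equiv.refl _))
      (fun i => (bernoulliMeasure true false p).real {s.2.2 i})

theorem integral_netLaw_relabelBlocks {n : ℕ} (p : unitInterval) (ρ : Equiv.Perm (Fin n))
    (f : Net n → ℝ) : ∫ s, f (relabelBlocks ρ s) ∂(netLaw n p) = ∫ s, f s ∂(netLaw n p) := by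
  rw [integral_netLaw, integral_netLaw,
    ← Equiv.sum_comp (relabelBlocks ρ) fun s => (netLaw n p).real {s} * f s]
  simp_rw [netLaw_real_relabelBlocks]

/-- Together with the invariance of the law, this is why one pair of constants serves all blocks. -/
theorem mixing_relabelBlocks {n : ℕ} (ρ : Equiv.Perm (Fin n)) (s : Net n) (j : Fin n) :
    mixing (relabelBlocks ρ s) j = mixing s (ρ j) := by
  have hr : received (relabelBlocks ρ s) j = received s (ρ j) := by
    ext a
    simp only [received, Finset.mem_filter, Finset.mem_univ, true_and]
    simp [relabelBlocks, owner]
  have hg : ∀ c, Gets (relabelBlocks ρ s) c j ↔ Gets s c (ρ j) := fun c => by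
    simp [Gets, relabelBlocks, owner]
  ext a c
  simp [mixing, hr, hg]

theorem netExpect_mixing_congr {n : ℕ} (p : unitInterval)
    (M : Matrix (Fin n) (Fin n) ℝ → Matrix (Fin n) (Fin n) ℝ) (i j : Fin n) :
    netExpect p (fun s => M (mixing s i)) = netExpect p (fun s => M (mixing s j)) := by
  ext a c
  simp only [netExpect, Matrix.of_apply]
  rw [← integral_netLaw_relabelBlocks p (Equiv.swap i j)]
  simp_rw [mixing_relabelBlocks, Equiv.swap_apply_left]

/-! ### The mixing matrices -/

theorem card_received_pos {n : ℕ} (s : Net n) (j : Fin n) : 0 < (received s j).card :=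
  Finset.card_pos.2 ⟨owner s j, by simp [received]⟩

theorem mixing_nonneg {n : ℕ} (s : Net n) (j a c : Fin n) : 0 ≤ mixing s j a c := by
  unfold mixing
  simp only [Matrix.of_apply]
  split_ifs <;> positivity

theorem sum_mixing {n : ℕ} (s : Net n) (j c : Fin n) : ∑ a, mixing s j a c = 1 := by
  unfold mixing
  simp only [Matrix.of_apply]
  split_ifs with h
  · have := card_received_pos s j
    rw [Finset.sum_ite_mem, Finset.univ_inter, Finset.sum_const, nsmul_eq_mul]
    field_simp
  · simp

theorem sum_sum_mixing {n : ℕ} (s : Net n) (j : Fin n) : ∑ a, ∑ c, mixing s j a c = n := by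
  refine Finset.sum_comm.trans ?_
  simp [sum_mixing]

theorem mixing_le_one {n : ℕ} (s : Net n) (j a c : Fin n) : mixing s j a c ≤ 1 :=
  (Finset.single_le_sum (fun a _ => mixing_nonneg s j a c) (Finset.mem_univ a)).trans_eq
    (sum_mixing s j c)

theorem sum_sq_mixing_le {n : ℕ} (s : Net n) (j c : Fin n) : ∑ a, mixing s j a c ^ 2 ≤ 1 := by
  rw [← sum_mixing s j c]
  exact Finset.sum_le_sum fun a _ => by
    nlinarith [mixing_nonneg s j a c, mixing_le_one s j a c]


/-- Cauchy–Schwarz against a column of norm at most one. This crude bound serves only for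
integrability. -/
theorem sq_vecMul_mixing_le {n : ℕ} (s : Net n) (j : Fin n) (u : Fin n → ℝ) (c : Fin n) :
    Matrix.vecMul u (mixing s j) c ^ 2 ≤ ∑ a, u a ^ 2 := by
  refine (Finset.sum_mul_sq_le_sq_mul_sq Finset.univ u fun a => mixing s j a c).trans ?_
  exact mul_le_of_le_one_right (by positivity) (sum_sq_mixing_le s j c)

theorem dotProduct_conj_mulVec {n : ℕ} (W A : Matrix (Fin n) (Fin n) ℝ) (u : Fin n → ℝ) :
    u ⬝ᵥ (W * A * W.transpose).mulVec u = Matrix.vecMul u W ⬝ᵥ A.mulVec (Matrix.vecMul u W) := by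
  rw [Matrix.dotProduct_mulVec, ← Matrix.vecMul_vecMul, ← Matrix.vecMul_vecMul,
    ← Matrix.dotProduct_mulVec, ← Matrix.dotProduct_mulVec, Matrix.mulVec_transpose]

theorem dotProduct_avgMatrix_mulVec {n : ℕ} (u : Fin n → ℝ) :
    u ⬝ᵥ (avgMatrix n).mulVec u = (∑ a, u a) ^ 2 / n := by
  simp only [dotProduct, Matrix.mulVec, avgMatrix, Matrix.of_apply, ← Finset.mul_sum,
    ← Finset.sum_mul]
  ring

theorem dotProduct_netExpect_mulVec {n : ℕ} (p : unitInterval)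
    (M : Net n → Matrix (Fin n) (Fin n) ℝ) (u w : Fin n → ℝ) :
    u ⬝ᵥ (netExpect p M).mulVec w = ∫ s, u ⬝ᵥ (M s).mulVec w ∂(netLaw n p) := by
  simp only [dotProduct, Matrix.mulVec, netExpect, Matrix.of_apply]
  rw [integral_finsetSum _ fun _ _ => integrable_netLaw p _]
  refine Finset.sum_congr rfl fun a _ => ?_
  rw [integral_const_mul, integral_finsetSum _ fun _ _ => integrable_netLaw p _]
  simp_rw [integral_mul_const]

theorem dotProduct_combination_mulVec {n : ℕ} (α : ℝ) (u : Fin n → ℝ) :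
    u ⬝ᵥ (α • (1 : Matrix (Fin n) (Fin n) ℝ) + (1 - α) • avgMatrix n).mulVec u
      = α * ∑ a, u a ^ 2 + (1 - α) * ((∑ a, u a) ^ 2 / n) := by
  rw [Matrix.add_mulVec, Matrix.smul_mulVec, Matrix.smul_mulVec, Matrix.one_mulVec,
    dotProduct_add, dotProduct_smul, dotProduct_smul, dotProduct_avgMatrix_mulVec]
  simp [dotProduct, sq]

theorem IsMixingPair.integral_sum_sq {n : ℕ} {p : unitInterval} {α₁ α₂ : ℝ}
    (h : IsMixingPair n p α₁ α₂) (j : Fin n) (u : Fin n → ℝ) :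
    ∫ s, ∑ c, Matrix.vecMul u (mixing s j) c ^ 2 ∂(netLaw n p)
      = α₁ * ∑ a, u a ^ 2 + (1 - α₁) * ((∑ a, u a) ^ 2 / n) := by
  rw [← dotProduct_combination_mulVec, ← h.second_moment j, dotProduct_netExpect_mulVec]
  congr with s
  have := dotProduct_conj_mulVec (mixing s j) 1 u
  rw [Matrix.mul_one, Matrix.one_mulVec] at this
  rw [this]
  simp [dotProduct, sq]

theorem IsMixingPair.integral_sq_sum {n : ℕ} {p : unitInterval} {α₁ α₂ : ℝ}
    (h : IsMixingPair n p α₁ α₂) (j : Fin n) (u : Fin n → ℝ) :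
    ∫ s, (∑ c, Matrix.vecMul u (mixing s j) c) ^ 2 / n ∂(netLaw n p)
      = α₂ * ∑ a, u a ^ 2 + (1 - α₂) * ((∑ a, u a) ^ 2 / n) := by
  rw [← dotProduct_combination_mulVec, ← h.averaged_second_moment j, dotProduct_netExpect_mulVec]
  congr with s
  rw [dotProduct_conj_mulVec, dotProduct_avgMatrix_mulVec]

/-! ### Symmetry -/

theorem netExpect_symm {n : ℕ} (p : unitInterval) (M : Net n → Matrix (Fin n) (Fin n) ℝ)
    (hM : ∀ π s a c, M (relabel π s) (π a) (π c) = M s a c) (π : Equiv.Perm (Fin n))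
    (a c : Fin n) : netExpect p M (π a) (π c) = netExpect p M a c := by
  simp only [netExpect, Matrix.of_apply]
  rw [← integral_netLaw_relabel p π]
  simp_rw [hM]

theorem sum_netExpect {n : ℕ} (p : unitInterval) (M : Net n → Matrix (Fin n) (Fin n) ℝ) :
    ∑ a, ∑ c, netExpect p M a c = ∫ s, ∑ a, ∑ c, M s a c ∂(netLaw n p) := by
  simp only [netExpect, Matrix.of_apply]
  rw [integral_finsetSum _ fun _ _ => integrable_netLaw p _]
  refine Finset.sum_congr rfl fun a _ => ?_
  rw [integral_finsetSum _ fun _ _ => integrable_netLaw p _]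

/-- For a single outcome only the columns of the mixing matrix sum to one. Symmetry between workers
makes all expected row sums equal, and their total is `n`, so each is one. Hence communication
preserves the average in expectation. -/
theorem integral_sum_vecMul_mixing {n : ℕ} (p : unitInterval) (j : Fin n) (u : Fin n → ℝ) :
    ∫ s, ∑ c, Matrix.vecMul u (mixing s j) c ∂(netLaw n p) = ∑ a, u a := by
  have key : ∀ a, ∑ c, netExpect p (fun s => mixing s j) a c = 1 := by
    have hsymm := netExpect_symm p (fun s => mixing s j) fun π s a c => mixing_relabel π s j a c
    set M := netExpect p (fun s => mixing s j) with hM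
    have hconst : ∀ a b, ∑ c, M a c = ∑ c, M b c := fun a b => by
      rw [← Equiv.sum_comp (Equiv.swap a b)]
      refine Finset.sum_congr rfl fun c _ => ?_
      rw [← hsymm (Equiv.swap a b) b c, Equiv.swap_apply_right]
    have htot : ∑ a, ∑ c, M a c = n := by
      rw [hM, sum_netExpect]
      simp [sum_sum_mixing]
    intro a
    have hn : (n : ℝ) ≠ 0 := by
      have := a.pos
      positivity
    rw [Finset.sum_congr rfl fun b _ => hconst b a] at htot
    simp only [Finset.sum_const, Finset.card_univ, Fintype.card_fin, nsmul_eq_mul] at htot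
    exact mul_left_cancel₀ hn (by rw [htot, mul_one])
  have h1 := dotProduct_netExpect_mulVec p (fun s => mixing s j) u 1
  have h2 : ∀ s : Net n, u ⬝ᵥ (mixing s j).mulVec 1 = ∑ c, Matrix.vecMul u (mixing s j) c :=
    fun s => by rw [Matrix.dotProduct_mulVec, dotProduct_one]
  simp_rw [h2] at h1
  rw [← h1]
  simp [dotProduct, Matrix.mulVec, key]

/-- A matrix that is invariant under simultaneous permutations of its rows and columns, and the
entries of which add up to `n`, is a combination of the identity and the averaging matrix. -/
theorem exists_eq_combination {n : ℕ} (M : Matrix (Fin n) (Fin n) ℝ)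
    (hsymm : ∀ (π : Equiv.Perm (Fin n)) a c, M (π a) (π c) = M a c)
    (hsum : ∑ a, ∑ c, M a c = n) (hn : 2 ≤ n) :
    ∃ α : ℝ, M = α • (1 : Matrix (Fin n) (Fin n) ℝ) + (1 - α) • avgMatrix n := by
  obtain ⟨k, rfl⟩ := Nat.exists_eq_add_of_le' hn
  have hdiag : ∀ a, M a a = M 0 0 := fun a => by
    have := hsymm (Equiv.swap 0 a) 0 0
    rwa [Equiv.swap_apply_left] at this
  have hoff : ∀ a c, a ≠ c → M a c = M 0 1 := fun a c hac => by
    -- An off-diagonal position is carried to `(0, 1)` by two transpositions: the first moves the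
    -- row to `0`, the second moves the column to `1` and fixes `0`.
    have h1 := hsymm (Equiv.swap 0 a) 0 (Equiv.swap 0 a c)
    rw [Equiv.swap_apply_left, Equiv.swap_apply_self] at h1
    set c' := Equiv.swap 0 a c with hc'
    have hc0 : c' ≠ 0 := by
      intro h
      apply hac
      have := congrArg (Equiv.swap 0 a) h
      rw [hc', Equiv.swap_apply_self, Equiv.swap_apply_left] at this
      exact this.symm
    have h2 := hsymm (Equiv.swap 1 c') 0 1
    rw [Equiv.swap_apply_left, Equiv.swap_apply_of_ne_of_ne (by simp) hc0.symm] at h2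
    rw [h1, h2]
  have hM : ∀ a c, M a c = if a = c then M 0 0 else M 0 1 := fun a c => by
    split_ifs with h
    · rw [h, hdiag]
    · exact hoff a c h
  set d := M 0 0
  set e := M 0 1
  have hn0 : ((k + 2 : ℕ) : ℝ) ≠ 0 := by positivity
  have hde : d + ((k + 2 : ℕ) - 1) * e = 1 := by
    have hrow : ∀ a : Fin (k + 2), ∑ c, M a c = d + ((k + 2 : ℕ) - 1) * e := fun a => by
      have : ∀ c, M a c = (if a = c then d - e else 0) + e := fun c => by
        rw [hM]; split_ifs <;> ring
      simp only [this, Finset.sum_add_distrib, Finset.sum_ite_eq, Finset.mem_univ, if_true,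
        Finset.sum_const, Finset.card_univ, Fintype.card_fin, nsmul_eq_mul]
      ring
    simp only [hrow, Finset.sum_const, Finset.card_univ, Fintype.card_fin, nsmul_eq_mul] at hsum
    exact mul_left_cancel₀ hn0 (by rw [hsum, mul_one])
  refine ⟨d - e, ?_⟩
  have he : (1 - (d - e)) * (1 / ((k + 2 : ℕ) : ℝ)) = e := by
    field_simp
    linarith
  ext a c
  simp only [Matrix.add_apply, Matrix.smul_apply, smul_eq_mul, avgMatrix, Matrix.of_apply,
    Matrix.one_apply, he]
  rw [hM]
  split_ifs <;> ring

theorem trace_combination {n : ℕ} (hn : 0 < n) (α : ℝ) :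
    (α • (1 : Matrix (Fin n) (Fin n) ℝ) + (1 - α) • avgMatrix n).trace = α * (n - 1) + 1 := by
  have : (n : ℝ) ≠ 0 := by positivity
  simp [Matrix.trace, avgMatrix]
  field_simp
  ring

theorem trace_netExpect {n : ℕ} (p : unitInterval) (M : Net n → Matrix (Fin n) (Fin n) ℝ) :
    (netExpect p M).trace = ∫ s, (M s).trace ∂(netLaw n p) := by
  simp only [Matrix.trace, Matrix.diag, netExpect, Matrix.of_apply]
  rw [integral_finsetSum _ fun _ _ => integrable_netLaw p _]

theorem sum_entries_eq {n : ℕ} (M : Matrix (Fin n) (Fin n) ℝ) :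
    ∑ a, ∑ c, M a c = (1 : Fin n → ℝ) ⬝ᵥ M.mulVec 1 := by
  simp [dotProduct, Matrix.mulVec]

theorem one_vecMul_mixing {n : ℕ} (s : Net n) (j : Fin n) :
    Matrix.vecMul 1 (mixing s j) = 1 := by
  ext c
  simp [Matrix.vecMul, dotProduct, sum_mixing]

theorem mixing_second_moment_relabel {n : ℕ} (π : Equiv.Perm (Fin n)) (s : Net n)
    (j a c : Fin n) :
    (mixing (relabel π s) j * (mixing (relabel π s) j).transpose) (π a) (π c)
      = (mixing s j * (mixing s j).transpose) a c := by
  simp only [Matrix.mul_apply, Matrix.transpose_apply]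
  rw [← Equiv.sum_comp π]
  simp_rw [mixing_relabel]

theorem mixing_averaged_second_moment_relabel {n : ℕ} (π : Equiv.Perm (Fin n)) (s : Net n)
    (j a c : Fin n) :
    (mixing (relabel π s) j * avgMatrix n * (mixing (relabel π s) j).transpose) (π a) (π c)
      = (mixing s j * avgMatrix n * (mixing s j).transpose) a c := by
  simp only [Matrix.mul_apply, Matrix.transpose_apply, avgMatrix, Matrix.of_apply]
  rw [← Equiv.sum_comp π]
  simp_rw [mixing_relabel]
  refine Finset.sum_congr rfl fun b _ => ?_
  rw [← Equiv.sum_comp π]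
  simp_rw [mixing_relabel]

theorem trace_mixing_second_moment {n : ℕ} (s : Net n) (j : Fin n) :
    (mixing s j * (mixing s j).transpose).trace = ∑ c, ∑ a, mixing s j a c ^ 2 := by
  rw [Finset.sum_comm]
  simp [Matrix.trace, Matrix.mul_apply, sq]

theorem trace_mixing_averaged_second_moment {n : ℕ} (s : Net n) (j : Fin n) :
    (mixing s j * avgMatrix n * (mixing s j).transpose).trace
      = ∑ a, (∑ c, mixing s j a c) ^ 2 / n := by
  simp only [Matrix.trace, Matrix.diag, Matrix.mul_apply, Matrix.transpose_apply, avgMatrix,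
    Matrix.of_apply, ← Finset.sum_mul, ← Finset.mul_sum]
  exact Finset.sum_congr rfl fun a _ => by ring

/-- Cauchy–Schwarz in each row; in expectation it gives `α₂ ≤ α₁`. -/
theorem trace_averaged_le_trace {n : ℕ} (s : Net n) (j : Fin n) :
    (mixing s j * avgMatrix n * (mixing s j).transpose).trace
      ≤ (mixing s j * (mixing s j).transpose).trace := by
  rw [trace_mixing_second_moment, trace_mixing_averaged_second_moment, Finset.sum_comm]
  refine Finset.sum_le_sum fun a _ => ?_
  have hn : (0 : ℝ) < n := by exact_mod_cast a.pos
  rw [div_le_iff₀ hn]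
  have := sq_sum_le_card_mul_sum_sq (s := Finset.univ) (f := fun c => mixing s j a c)
  simpa [mul_comm] using this

/-- The `n` row sums add up to `n`, so by Cauchy–Schwarz their squares add up to at least `n`. In
expectation this gives `0 ≤ α₂`. -/
theorem one_le_trace_averaged {n : ℕ} (s : Net n) (j : Fin n) :
    1 ≤ (mixing s j * avgMatrix n * (mixing s j).transpose).trace := by
  rw [trace_mixing_averaged_second_moment, ← Finset.sum_div]
  have hn : (0 : ℝ) < n := by exact_mod_cast j.pos
  rw [le_div_iff₀ hn, one_mul]
  have h := sq_sum_le_card_mul_sum_sq (s := Finset.univ) (f := fun a => ∑ c, mixing s j a c)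
  rw [sum_sum_mixing, Finset.card_univ, Fintype.card_fin] at h
  nlinarith

theorem trace_second_moment_le {n : ℕ} (s : Net n) (j : Fin n) :
    (mixing s j * (mixing s j).transpose).trace ≤ n := by
  rw [trace_mixing_second_moment]
  exact (Finset.sum_le_sum fun c _ => sum_sq_mixing_le s j c).trans_eq (by simp)

theorem trace_second_moment_lossless_lt {n : ℕ} (hn : 2 ≤ n) (j : Fin n) :
    (mixing ((1 : Equiv.Perm (Fin n)), (fun _ => false), (fun _ => false)) j *
      (mixing ((1 : Equiv.Perm (Fin n)), (fun _ => false), (fun _ => false)) j).transpose).trace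
      < n := by
  rw [trace_mixing_second_moment]
  have h0 : (n : ℝ) ≠ 0 := by positivity
  simp [mixing, Gets, received]
  field_simp
  exact_mod_cast hn

/-- Symmetry gives the form of both matrices. Since the trace of such a combination is `α * (n - 1)
+ 1`, the inequalities between the constants reduce to inequalities between traces that hold for
every outcome. -/
theorem exists_isMixingPair {n : ℕ} (hn : 0 < n) {p : unitInterval} (hp : (p : ℝ) < 1) :
    ∃ α₁ α₂ : ℝ, IsMixingPair n p α₁ α₂ := by
  obtain rfl | hn2 : n = 1 ∨ 2 ≤ n := by omega
  · refine ⟨0, 0, le_rfl, le_rfl, one_pos, fun j => ?_, fun j => ?_⟩ <;>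
    · ext a c
      have hm : ∀ s : Net 1, mixing s j = 1 := fun s => by
        ext a c
        have := sum_mixing s j c
        rw [Fin.sum_univ_one] at this
        rw [Subsingleton.elim a 0, this, Subsingleton.elim c 0]
        simp
      simp [hm, netExpect, avgMatrix, Subsingleton.elim a c]
  have hn' : (0 : ℝ) < n - 1 := by
    have : (2 : ℝ) ≤ n := by exact_mod_cast hn2
    linarith
  have hex₁ : ∀ j : Fin n, ∃ α : ℝ, netExpect p (fun s => mixing s j * (mixing s j).transpose)
      = α • (1 : Matrix (Fin n) (Fin n) ℝ) + (1 - α) • avgMatrix n := fun j => by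
    refine exists_eq_combination _ (netExpect_symm p _ fun π s a c =>
      mixing_second_moment_relabel π s j a c) ?_ hn2
    rw [sum_netExpect]
    have : ∀ s, ∑ a, ∑ c, (mixing s j * (mixing s j).transpose) a c = n := fun s => by
      have := dotProduct_conj_mulVec (mixing s j) 1 1
      rw [Matrix.mul_one, Matrix.one_mulVec, one_vecMul_mixing] at this
      rw [sum_entries_eq, this]
      simp [dotProduct]
    simp [this]
  have hex₂ : ∀ j : Fin n, ∃ α : ℝ,
      netExpect p (fun s => mixing s j * avgMatrix n * (mixing s j).transpose)
      = α • (1 : Matrix (Fin n) (Fin n) ℝ) + (1 - α) • avgMatrix n := fun j => by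
    refine exists_eq_combination _ (netExpect_symm p _ fun π s a c =>
      mixing_averaged_second_moment_relabel π s j a c) ?_ hn2
    rw [sum_netExpect]
    have : ∀ s, ∑ a, ∑ c, (mixing s j * avgMatrix n * (mixing s j).transpose) a c = n :=
      fun s => by
        rw [sum_entries_eq, dotProduct_conj_mulVec, one_vecMul_mixing,
          dotProduct_avgMatrix_mulVec]
        simp [sq]
    simp [this]
  let j₀ : Fin n := ⟨0, hn⟩
  obtain ⟨α₁, h₁⟩ := hex₁ j₀
  obtain ⟨α₂, h₂⟩ := hex₂ j₀
  have ht₁ := trace_combination hn α₁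
  have ht₂ := trace_combination hn α₂
  rw [← h₁, trace_netExpect] at ht₁
  rw [← h₂, trace_netExpect] at ht₂
  refine ⟨α₁, α₂, ?_, ?_, ?_, fun j => ?_, fun j => ?_⟩
  · have : (1 : ℝ) ≤ ∫ s, (mixing s j₀ * avgMatrix n * (mixing s j₀).transpose).trace
        ∂(netLaw n p) := by
      have := integral_mono (integrable_netLaw p fun _ => (1 : ℝ)) (integrable_netLaw p _)
        fun s => one_le_trace_averaged s j₀
      simpa using this
    rw [ht₂] at this
    by_contra hneg
    nlinarith
  · have := integral_mono (integrable_netLaw p _) (integrable_netLaw p _)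
        fun s => trace_averaged_le_trace s j₀
    rw [ht₁, ht₂] at this
    by_contra hneg
    nlinarith
  -- The trace never exceeds `n`, and it is strictly smaller on the lossless outcome, an atom of
  -- positive mass.
  · have hlt : ∫ s, (mixing s j₀ * (mixing s j₀).transpose).trace ∂(netLaw n p) < n := by
      rw [integral_netLaw]
      calc _ < ∑ s, (netLaw n p).real {s} * (n : ℝ) := by
            refine Finset.sum_lt_sum (fun s _ => ?_)
              ⟨((1 : Equiv.Perm (Fin n)), (fun _ => false), (fun _ => false)),
                Finset.mem_univ _, ?_⟩
            · exact mul_le_mul_of_nonneg_left (trace_second_moment_le s j₀) measureReal_nonneg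
            · exact mul_lt_mul_of_pos_left (trace_second_moment_lossless_lt hn2 j₀)
                (netLaw_real_singleton_pos hp)
        _ = n := by rw [← Finset.sum_mul, sum_netLaw, one_mul]
    rw [ht₁] at hlt
    by_contra hneg
    nlinarith
  · rw [← h₁]
    exact netExpect_mixing_congr p (fun W => W * W.transpose) j j₀
  · rw [← h₂]
    exact netExpect_mixing_congr p (fun W => W * avgMatrix n * W.transpose) j j₀

/-! ### Averages and deviations of families of models -/

section Deviation

variable {n m : ℕ}

/-- The sum of the squared distances of the local models from their average. -/
def deviation (x : Fin n → Model n m) : ℝ := ∑ i, ‖x i - average x‖ ^ 2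

theorem deviation_nonneg (x : Fin n → Model n m) : 0 ≤ deviation x :=
  Finset.sum_nonneg fun _ _ => by positivity

theorem nsmul_average (x : Fin n → Model n m) : (n : ℝ) • average x = ∑ i, x i := by
  rcases Nat.eq_zero_or_pos n with rfl | hn
  · simp
  · rw [average, smul_smul, mul_one_div_cancel (by positivity), one_smul]

/-- The parallel axis identity: the cross terms vanish because deviations from the average sum to
zero. -/
theorem sum_norm_sq_sub (x : Fin n → Model n m) (w : Model n m) :
    ∑ i, ‖x i - w‖ ^ 2 = deviation x + n * ‖average x - w‖ ^ 2 := by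
  have h : ∀ i, ‖x i - w‖ ^ 2 = ‖x i - average x‖ ^ 2
      + 2 * inner ℝ (x i - average x) (average x - w) + ‖average x - w‖ ^ 2 := fun i => by
    rw [← norm_add_sq_real]; simp
  simp_rw [h, Finset.sum_add_distrib, ← Finset.mul_sum, ← sum_inner, Finset.sum_sub_distrib,
    ← nsmul_average x]
  simp [deviation, Nat.cast_smul_eq_nsmul]

theorem deviation_eq (x : Fin n → Model n m) :
    deviation x = ∑ i, ‖x i‖ ^ 2 - n * ‖average x‖ ^ 2 := by
  have := sum_norm_sq_sub x 0
  simp only [sub_zero] at this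
  linarith

theorem deviation_le (x : Fin n → Model n m) (w : Model n m) :
    deviation x ≤ ∑ i, ‖x i - w‖ ^ 2 := by
  rw [sum_norm_sq_sub]
  have : (0 : ℝ) ≤ n * ‖average x - w‖ ^ 2 := by positivity
  linarith

theorem average_add (x y : Fin n → Model n m) :
    average (fun i => x i + y i) = average x + average y := by
  simp [average, Finset.sum_add_distrib]

theorem average_sub (x y : Fin n → Model n m) :
    average (fun i => x i - y i) = average x - average y := by
  simp [average, Finset.sum_sub_distrib, smul_sub]

theorem average_smul (c : ℝ) (x : Fin n → Model n m) :
    average (fun i => c • x i) = c • average x := by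
  simp only [average, ← Finset.smul_sum]
  rw [smul_comm]

theorem norm_average_sq_le (x : Fin n → Model n m) :
    n * ‖average x‖ ^ 2 ≤ ∑ i, ‖x i‖ ^ 2 := by
  have := deviation_nonneg x
  rw [deviation_eq] at this
  linarith

/-- Young's inequality for the deviation of a gradient step. -/
theorem deviation_sub_smul_le (x g : Fin n → Model n m) (γ : ℝ) {a b q : ℝ}
    (hab : ∀ s t : ℝ, q * (s + t) ^ 2 ≤ a * s ^ 2 + b * t ^ 2)
    (hq : 0 ≤ q) :
    q * deviation (fun i => x i - γ • g i) ≤ a * deviation x + b * γ ^ 2 * deviation g := by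
  simp only [deviation]
  rw [Finset.mul_sum, Finset.mul_sum, Finset.mul_sum, ← Finset.sum_add_distrib]
  refine Finset.sum_le_sum fun i _ => ?_
  rw [average_sub x (fun i => γ • g i), average_smul]
  have h : x i - γ • g i - (average x - γ • average g)
      = (x i - average x) - γ • (g i - average g) := by
    rw [smul_sub]; abel
  rw [h]
  have h1 : ‖(x i - average x) - γ • (g i - average g)‖
      ≤ ‖x i - average x‖ + |γ| * ‖g i - average g‖ := by
    refine (norm_sub_le _ _).trans_eq ?_
    rw [norm_smul, Real.norm_eq_abs]
  calc _ ≤ q * (‖x i - average x‖ + |γ| * ‖g i - average g‖) ^ 2 := by gcongr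
    _ ≤ _ := hab _ _
    _ = _ := by rw [mul_pow, sq_abs]; ring

end Deviation

/-! ### One communication round -/

section Communicate

variable {n m : ℕ}

theorem communicate_apply (s : Net n) (v : Fin n → Model n m) (c : Fin n)
    (jk : Fin n × Fin m) :
    communicate s v c jk = Matrix.vecMul (fun a => v a jk) (mixing s jk.1) c :=
  communicate_eq_mixing s v c jk.1 jk.2

theorem norm_sq_communicate_le (s : Net n) (v : Fin n → Model n m) (c : Fin n) :
    ‖communicate s v c‖ ^ 2 ≤ ∑ a, ‖v a‖ ^ 2 := by
  simp_rw [EuclideanSpace.real_norm_sq_eq]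
  rw [Finset.sum_comm]
  refine Finset.sum_le_sum fun jk _ => ?_
  rw [communicate_apply]
  exact sq_vecMul_mixing_le s jk.1 _ c

theorem average_apply (v : Fin n → Model n m) (jk : Fin n × Fin m) :
    average v jk = (∑ a, v a jk) / n := by
  simp [average, div_eq_inv_mul]

variable {p : unitInterval} {α₁ α₂ : ℝ}

theorem IsMixingPair.integral_sum_norm_sq_communicate (h : IsMixingPair n p α₁ α₂)
    (v : Fin n → Model n m) :
    ∫ s, ∑ c, ‖communicate s v c‖ ^ 2 ∂(netLaw n p)
      = α₁ * ∑ a, ‖v a‖ ^ 2 + (1 - α₁) * (n * ‖average v‖ ^ 2) := by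
  have h1 : ∀ s, ∑ c, ‖communicate s v c‖ ^ 2
      = ∑ jk : Fin n × Fin m, ∑ c, Matrix.vecMul (fun a => v a jk) (mixing s jk.1) c ^ 2 :=
    fun s => by
      simp_rw [EuclideanSpace.real_norm_sq_eq]
      rw [Finset.sum_comm]
      simp_rw [communicate_apply]
  simp_rw [h1]
  rw [integral_finsetSum _ fun _ _ => integrable_netLaw p _]
  simp_rw [h.integral_sum_sq, EuclideanSpace.real_norm_sq_eq]
  rw [Finset.sum_add_distrib, ← Finset.mul_sum, ← Finset.mul_sum, Finset.sum_comm]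
  congr 2
  rw [Finset.mul_sum]
  refine Finset.sum_congr rfl fun jk _ => ?_
  have : (n : ℝ) ≠ 0 := by
    have := jk.1.pos
    positivity
  rw [average_apply]
  field_simp

theorem IsMixingPair.integral_norm_sq_average_communicate (h : IsMixingPair n p α₁ α₂)
    (v : Fin n → Model n m) :
    ∫ s, n * ‖average (communicate s v)‖ ^ 2 ∂(netLaw n p)
      = α₂ * ∑ a, ‖v a‖ ^ 2 + (1 - α₂) * (n * ‖average v‖ ^ 2) := by
  have h1 : ∀ s, n * ‖average (communicate s v)‖ ^ 2
      = ∑ jk : Fin n × Fin m,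
        (∑ c, Matrix.vecMul (fun a => v a jk) (mixing s jk.1) c) ^ 2 / n :=
    fun s => by
      rw [EuclideanSpace.real_norm_sq_eq, Finset.mul_sum]
      refine Finset.sum_congr rfl fun jk _ => ?_
      have : (n : ℝ) ≠ 0 := by
        have := jk.1.pos
        positivity
      rw [average_apply]
      simp_rw [communicate_apply]
      field_simp
  simp_rw [h1]
  rw [integral_finsetSum _ fun _ _ => integrable_netLaw p _]
  simp_rw [h.integral_sq_sum, EuclideanSpace.real_norm_sq_eq]
  rw [Finset.sum_add_distrib, ← Finset.mul_sum, ← Finset.mul_sum, Finset.sum_comm]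
  congr 2
  rw [Finset.mul_sum]
  refine Finset.sum_congr rfl fun jk _ => ?_
  have : (n : ℝ) ≠ 0 := by
    have := jk.1.pos
    positivity
  rw [average_apply]
  field_simp

theorem integral_inner_average_communicate (v : Fin n → Model n m) (w : Model n m) :
    ∫ s, inner ℝ w (average (communicate s v)) ∂(netLaw n p) = inner ℝ w (average v) := by
  simp_rw [PiLp.inner_apply, average_apply, communicate_apply]
  rw [integral_finsetSum _ fun _ _ => integrable_netLaw p _]
  refine Finset.sum_congr rfl fun jk _ => ?_
  simp only [RCLike.inner_apply, conj_trivial]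
  rw [integral_mul_const, integral_div, integral_sum_vecMul_mixing]

/-- The deviation is the sum of squares minus `n` times the square of the average. Subtracting the
two moment identities leaves the same expression with factor `α₁ - α₂`. -/
theorem IsMixingPair.integral_deviation_communicate (h : IsMixingPair n p α₁ α₂)
    (v : Fin n → Model n m) :
    ∫ s, deviation (communicate s v) ∂(netLaw n p) = (α₁ - α₂) * deviation v := by
  simp_rw [deviation_eq]
  rw [integral_sub (integrable_netLaw p _) (integrable_netLaw p _),
    h.integral_sum_norm_sq_communicate, h.integral_norm_sq_average_communicate]
  ring

/-- A bias–variance decomposition: the average is unbiased under communication, and its variance is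
`α₂ / n` times the deviation. -/
theorem IsMixingPair.integral_norm_sq_average_communicate_sub (h : IsMixingPair n p α₁ α₂)
    (v : Fin n → Model n m) (w : Model n m) :
    ∫ s, n * ‖average (communicate s v) - w‖ ^ 2 ∂(netLaw n p)
      = n * ‖average v - w‖ ^ 2 + α₂ * deviation v := by
  have h1 : ∀ z : Model n m, n * ‖z - w‖ ^ 2
      = (n * ‖z‖ ^ 2 - 2 * n * inner ℝ w z) + n * ‖w‖ ^ 2 := fun z => by
    rw [norm_sub_sq_real, real_inner_comm]; ring
  simp_rw [h1]
  rw [integral_add (integrable_netLaw p _) (integrable_netLaw p _),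
    integral_sub (integrable_netLaw p _) (integrable_netLaw p _),
    h.integral_norm_sq_average_communicate, integral_const_mul,
    integral_inner_average_communicate, deviation_eq]
  simp
  ring

end Communicate

/-! ### Unbiasedness of the stochastic gradients -/

section Unbiased

open Filter Topology

theorem sq_intervalIntegral_le {u : ℝ → ℝ} {h : ℝ} (hh : 0 < h)
    (hu : IntervalIntegrable u volume 0 h)
    (hu2 : IntervalIntegrable (fun s => u s ^ 2) volume 0 h) :
    (∫ s in 0..h, u s) ^ 2 ≤ h * ∫ s in 0..h, u s ^ 2 := by
  set I := ∫ s in 0..h, u s with hI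
  -- Cauchy–Schwarz as nonnegativity of the variance: `a` is the mean of `u` over the interval.
  set a := I / h with ha
  have h0 : 0 ≤ ∫ s in 0..h, (u s - a) ^ 2 :=
    intervalIntegral.integral_nonneg hh.le fun s _ => sq_nonneg _
  have h1 : ∫ s in 0..h, (u s - a) ^ 2 = (∫ s in 0..h, u s ^ 2) - 2 * a * I + a ^ 2 * h := by
    have : ∀ s, (u s - a) ^ 2 = (u s ^ 2 - 2 * a * u s) + a ^ 2 := fun s => by ring
    simp_rw [this]
    rw [intervalIntegral.integral_add (hu2.sub (hu.const_mul _)) (by simp),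
      intervalIntegral.integral_sub hu2 (hu.const_mul _), intervalIntegral.integral_const_mul]
    simp [hI]
    ring
  have h2 : a * h = I := by rw [ha]; field_simp
  rw [h1] at h0
  nlinarith

/-- A function on an interval with a square integrable derivative satisfies the
Cauchy–Schwarz bound for its increments. -/
theorem ofReal_sq_sub_le_lintegral {φ u : ℝ → ℝ} {h : ℝ} (hh : 0 < h)
    (hφ : ∀ s, HasDerivAt φ (u s) s) (hu : Measurable u) :
    ENNReal.ofReal ((φ h - φ 0) ^ 2)
      ≤ ENNReal.ofReal h * ∫⁻ s in Set.Ioc 0 h, ENNReal.ofReal (u s ^ 2) := by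
  -- The bound is stated in extended reals since the derivative need not be square integrable along
  -- the segment for every data point. In the infinite case it is trivial; otherwise the derivative
  -- is integrable and the fundamental theorem of calculus applies.
  by_cases htop : ∫⁻ s in Set.Ioc 0 h, ENNReal.ofReal (u s ^ 2) = ⊤
  · rw [htop, ENNReal.mul_top (by simpa using hh)]
    exact le_top
  have hu2 : IntegrableOn (fun s => u s ^ 2) (Set.Ioc 0 h) := by
    refine ⟨(hu.pow_const 2).aestronglyMeasurable, ?_⟩
    rw [hasFiniteIntegral_iff_ofReal (ae_of_all _ fun s => sq_nonneg _)]
    exact lt_top_iff_ne_top.2 htop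
  have hu1 : IntegrableOn u (Set.Ioc 0 h) := by
    have : MemLp u 2 (volume.restrict (Set.Ioc 0 h)) :=
      (memLp_two_iff_integrable_sq hu.aestronglyMeasurable).2 hu2
    exact this.integrable (by norm_num)
  have hi1 : IntervalIntegrable u volume 0 h :=
    (intervalIntegrable_iff_integrableOn_Ioc_of_le hh.le).2 hu1
  have hi2 : IntervalIntegrable (fun s => u s ^ 2) volume 0 h :=
    (intervalIntegrable_iff_integrableOn_Ioc_of_le hh.le).2 hu2
  rw [← ofReal_integral_eq_lintegral_ofReal hu2 (ae_of_all _ fun s => sq_nonneg _),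
    ← ENNReal.ofReal_mul hh.le]
  refine ENNReal.ofReal_le_ofReal ?_
  rw [← intervalIntegral.integral_eq_sub_of_hasDerivAt (fun s _ => hφ s) hi1,
    ← intervalIntegral.integral_of_le hh.le]
  exact sq_intervalIntegral_le hh hi1 hi2

/-- Pointwise convergence together with a uniform bound of the second moments implies
convergence of the expectations. -/
theorem tendsto_integral_of_sq_bound {Ξ : Type*} [MeasurableSpace Ξ] {μ : Measure Ξ}
    [IsProbabilityMeasure μ] {Δ : ℕ → Ξ → ℝ} {δ : Ξ → ℝ} {C : ℝ}
    (hΔ : ∀ k, MemLp (Δ k) 2 μ) (hδ : MemLp δ 2 μ)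
    (hΔC : ∀ k, ∫ ξ, Δ k ξ ^ 2 ∂μ ≤ C) (hδC : ∫ ξ, δ ξ ^ 2 ∂μ ≤ C)
    (hlim : ∀ ξ, Tendsto (fun k => Δ k ξ) atTop (𝓝 (δ ξ))) :
    Tendsto (fun k => ∫ ξ, Δ k ξ ∂μ) atTop (𝓝 (∫ ξ, δ ξ ∂μ)) := by
  have hC : 0 ≤ C := (integral_nonneg fun ξ => sq_nonneg (δ ξ)).trans hδC
  rw [Metric.tendsto_atTop]
  intro ε hε
  -- Truncation level: the part of the difference above `M` contributes at most `4 * C / M ≤ ε / 2`,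
  -- and the truncated part converges by dominated convergence. The summand `1` keeps `M` positive
  -- when `C = 0`.
  set M := 8 * C / ε + 1 with hM
  have hMpos : 0 < M := by positivity
  have hd : ∀ k, MemLp (fun ξ => Δ k ξ - δ ξ) 2 μ := fun k => (hΔ k).sub hδ
  have hdom : Tendsto (fun k => ∫ ξ, min |Δ k ξ - δ ξ| M ∂μ) atTop (𝓝 (∫ _, (0 : ℝ) ∂μ)) := by
    refine tendsto_integral_of_dominated_convergence (fun _ => M) (fun k => ?_)
      (integrable_const M) (fun k => ae_of_all _ fun ξ => ?_) (ae_of_all _ fun ξ => ?_)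
    · exact ((hd k).1.norm.inf aestronglyMeasurable_const)
    · rw [Real.norm_of_nonneg (le_min (abs_nonneg _) hMpos.le)]
      exact min_le_right _ _
    · have h1 : Tendsto (fun k => |Δ k ξ - δ ξ|) atTop (𝓝 0) := by
        have := ((hlim ξ).sub_const (δ ξ)).abs
        simpa using this
      have h2 := h1.min (tendsto_const_nhds (x := M))
      rwa [min_eq_left hMpos.le] at h2
  rw [integral_zero, Metric.tendsto_atTop] at hdom
  obtain ⟨N, hN⟩ := hdom (ε / 2) (by positivity)
  refine ⟨N, fun k hk => ?_⟩
  have hNk := hN k hk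
  rw [Real.dist_eq, sub_zero] at hNk
  have hΔi := (hΔ k).integrable (by norm_num : (1 : ENNReal) ≤ 2)
  have hδi := hδ.integrable (by norm_num : (1 : ENNReal) ≤ 2)
  have hmin : Integrable (fun ξ => min |Δ k ξ - δ ξ| M) μ :=
    (hΔi.sub hδi).abs.inf (integrable_const M)
  have hΔ2 := (hΔ k).integrable_sq
  have hδ2 := hδ.integrable_sq
  rw [Real.dist_eq, ← integral_sub hΔi hδi]
  have hrest : Integrable (fun ξ => 2 / M * Δ k ξ ^ 2 + 2 / M * δ ξ ^ 2) μ :=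
    (hΔ2.const_mul _).add (hδ2.const_mul _)
  have hpt : ∀ ξ, |Δ k ξ - δ ξ|
      ≤ min |Δ k ξ - δ ξ| M + (2 / M * Δ k ξ ^ 2 + 2 / M * δ ξ ^ 2) := fun ξ => by
    have hsq : (Δ k ξ - δ ξ) ^ 2 / M ≤ 2 / M * Δ k ξ ^ 2 + 2 / M * δ ξ ^ 2 := by
      rw [div_mul_eq_mul_div, div_mul_eq_mul_div, ← add_div]
      gcongr
      nlinarith [sq_nonneg (Δ k ξ + δ ξ)]
    rcases le_total |Δ k ξ - δ ξ| M with h | h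
    · rw [min_eq_left h]
      have : 0 ≤ (Δ k ξ - δ ξ) ^ 2 / M := by positivity
      linarith
    · rw [min_eq_right h]
      have : |Δ k ξ - δ ξ| ≤ (Δ k ξ - δ ξ) ^ 2 / M := by
        rw [le_div_iff₀ hMpos, ← sq_abs, sq]
        gcongr
      linarith
  calc |∫ ξ, (Δ k ξ - δ ξ) ∂μ| ≤ ∫ ξ, |Δ k ξ - δ ξ| ∂μ := abs_integral_le_integral_abs
    _ ≤ ∫ ξ, (min |Δ k ξ - δ ξ| M + (2 / M * Δ k ξ ^ 2 + 2 / M * δ ξ ^ 2)) ∂μ :=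
        integral_mono (hΔi.sub hδi).abs
          (hmin.add hrest) hpt
    _ = ∫ ξ, min |Δ k ξ - δ ξ| M ∂μ
          + (2 / M * ∫ ξ, Δ k ξ ^ 2 ∂μ + 2 / M * ∫ ξ, δ ξ ^ 2 ∂μ) := by
        rw [integral_add hmin hrest, integral_add (hΔ2.const_mul _) (hδ2.const_mul _),
          integral_const_mul, integral_const_mul]
    _ ≤ ∫ ξ, min |Δ k ξ - δ ξ| M ∂μ + (2 / M * C + 2 / M * C) := by
        gcongr
        · exact hΔC k
    _ < ε / 2 + ε / 2 := by
        have h4 : 2 / M * C + 2 / M * C ≤ ε / 2 := by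
          rw [← two_mul, div_mul_eq_mul_div, mul_div_assoc', div_le_iff₀ hMpos, hM]
          field_simp
          nlinarith
        have := (abs_lt.1 hNk).2
        linarith
    _ = ε := by ring

/-! ### Gradients as limits of difference quotients -/

theorem hasDerivAt_comp_line {E : Type*} [NormedAddCommGroup E] [InnerProductSpace ℝ E]
    [CompleteSpace E] {g : E → ℝ} (hg : Differentiable ℝ g) (x e : E) (s : ℝ) :
    HasDerivAt (fun r : ℝ => g (x + r • e)) (inner ℝ (gradient g (x + s • e)) e) s := by
  have h1 := (hg (x + s • e)).hasGradientAt.hasFDerivAt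
  have h2 : HasDerivAt (fun r : ℝ => x + r • e) e s := by
    simpa using ((hasDerivAt_id s).smul_const e).const_add x
  have h3 := h1.comp_hasDerivAt s h2
  rwa [InnerProductSpace.toDual_apply_apply] at h3

/-- The difference quotient of `g` at `x` along `e / (k + 1)`. -/
def diffQuotient {E : Type*} [NormedAddCommGroup E] [NormedSpace ℝ E] (g : E → ℝ) (x e : E)
    (k : ℕ) : ℝ :=
  ((k : ℝ) + 1) * (g (x + (1 / ((k : ℝ) + 1)) • e) - g x)

theorem tendsto_diffQuotient {E : Type*} [NormedAddCommGroup E] [InnerProductSpace ℝ E]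
    [CompleteSpace E] {g : E → ℝ} (hg : Differentiable ℝ g) (x e : E) :
    Tendsto (diffQuotient g x e) atTop (𝓝 (inner ℝ (gradient g x) e)) := by
  have h := (hasDerivAt_comp_line hg x e 0).tendsto_slope_zero
  have hk : Tendsto (fun k : ℕ => 1 / ((k : ℝ) + 1)) atTop (𝓝[≠] 0) := by
    refine tendsto_nhdsWithin_iff.2 ⟨tendsto_one_div_add_atTop_nhds_zero_nat,
      Eventually.of_forall fun k => ?_⟩
    have : (0 : ℝ) < 1 / ((k : ℝ) + 1) := by positivity
    exact this.ne'
  have h2 := h.comp hk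
  simp only [zero_smul, add_zero, zero_add] at h2
  refine h2.congr fun k => ?_
  simp [diffQuotient]

section Parametric

variable {n m : ℕ} {Ξ : Type*} [MeasurableSpace Ξ] {G : Model n m → Ξ → ℝ}

/-- Each coordinate is a pointwise limit of difference quotients, which are jointly measurable. -/
theorem measurable_gradient_uncurry (hmeas : Measurable (Function.uncurry G))
    (hdiff : ∀ ξ, Differentiable ℝ (fun x => G x ξ)) :
    Measurable (fun z : Model n m × Ξ => gradient (fun y => G y z.2) z.1) := by
  have hcoord : ∀ jk, Measurable (fun z : Model n m × Ξ => gradient (fun y => G y z.2) z.1 jk) := by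
    intro jk
    have hlim : ∀ z : Model n m × Ξ, Tendsto (fun k => diffQuotient (fun y => G y z.2) z.1
        (EuclideanSpace.single jk 1) k) atTop (𝓝 (gradient (fun y => G y z.2) z.1 jk)) :=
      fun z => by
        have := tendsto_diffQuotient (hdiff z.2) z.1 (EuclideanSpace.single jk 1)
        rw [EuclideanSpace.inner_single_right] at this
        simpa only [one_mul, conj_trivial] using this
    refine measurable_of_tendsto_metrizable (fun k => ?_) (tendsto_pi_nhds.2 hlim)
    have h1 : Measurable fun z : Model n m × Ξ =>
        G (z.1 + (1 / ((k : ℝ) + 1)) • EuclideanSpace.single jk 1) z.2 :=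
      hmeas.comp ((measurable_fst.add_const _).prodMk measurable_snd)
    exact (h1.sub hmeas).const_mul _
  exact (WithLp.measurable_toLp 2 _).comp (measurable_pi_lambda _ hcoord)

variable {μ : Measure Ξ} [IsProbabilityMeasure μ]

/-- Stochastic gradients with bounded variance are unbiased. -/
theorem integral_gradient_eq (hmeas : Measurable (Function.uncurry G))
    (hint : ∀ x, Integrable (G x) μ) (hdiff : ∀ ξ, Differentiable ℝ (fun x => G x ξ))
    (hg : Differentiable ℝ (fun x => ∫ ξ, G x ξ ∂μ)) {L σ : ℝ}
    (hLip : ∀ x y, ‖gradient (fun x => ∫ ξ, G x ξ ∂μ) x - gradient (fun x => ∫ ξ, G x ξ ∂μ) y‖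
      ≤ L * ‖x - y‖)
    (hσ : ∀ x, Integrable (fun ξ => ‖gradient (fun y => G y ξ) x
        - gradient (fun x => ∫ ξ, G x ξ ∂μ) x‖ ^ 2) μ ∧
      ∫ ξ, ‖gradient (fun y => G y ξ) x - gradient (fun x => ∫ ξ, G x ξ ∂μ) x‖ ^ 2 ∂μ ≤ σ ^ 2)
    (hL : 0 ≤ L) (x : Model n m) :
    Integrable (fun ξ => gradient (fun y => G y ξ) x) μ ∧
      ∫ ξ, gradient (fun y => G y ξ) x ∂μ = gradient (fun x => ∫ ξ, G x ξ ∂μ) x := by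
  set g : Model n m → ℝ := fun x => ∫ ξ, G x ξ ∂μ with hgdef
  have hgm : Measurable (fun z : Model n m × Ξ => gradient (fun y => G y z.2) z.1) :=
    measurable_gradient_uncurry hmeas hdiff
  have hgx : ∀ y, Measurable fun ξ => gradient (fun z => G z ξ) y := fun y =>
    hgm.comp (measurable_const.prodMk measurable_id)
  have hmem : ∀ y, MemLp (fun ξ => gradient (fun z => G z ξ) y) 2 μ := fun y => by
    have h1 : MemLp (fun ξ => gradient (fun z => G z ξ) y - gradient g y) 2 μ :=
      (memLp_two_iff_integrable_sq_norm ((hgx y).sub_const _).aestronglyMeasurable).2 (hσ y).1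
    have h2 := h1.add (memLp_const (gradient g y))
    exact h2.congr_norm (hgx y).aestronglyMeasurable (ae_of_all _ fun ξ => by simp)
  have hi : ∀ y, Integrable (fun ξ => gradient (fun z => G z ξ) y) μ := fun y =>
    (hmem y).integrable (by norm_num)
  refine ⟨hi x, ?_⟩
  refine ext_inner_right ℝ fun e => ?_
  rw [real_inner_comm, ← integral_inner (hi x)]
  simp_rw [real_inner_comm _ e]
  -- By the Lipschitz bound, `B` dominates the gradient of `g` along the whole segment from `x` to
  -- `x + e`, so the second moments there are bounded uniformly.
  set B := ‖gradient g x‖ + L * ‖e‖ with hB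
  have hsq : ∀ s ∈ Set.Icc (0 : ℝ) 1,
      ∫⁻ ξ, ENNReal.ofReal (inner ℝ (gradient (fun y => G y ξ) (x + s • e)) e ^ 2) ∂μ
        ≤ ENNReal.ofReal (‖e‖ ^ 2 * (2 * σ ^ 2 + 2 * B ^ 2)) := by
    intro s hs
    set y := x + s • e with hy
    have hBy : ‖gradient g y‖ ≤ B := by
      have h1 := hLip y x
      have h2 : ‖y - x‖ ≤ ‖e‖ := by
        rw [hy, add_sub_cancel_left, norm_smul, Real.norm_of_nonneg hs.1]
        exact mul_le_of_le_one_left (norm_nonneg _) hs.2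
      have h3 : ‖gradient g y‖ ≤ ‖gradient g x‖ + ‖gradient g y - gradient g x‖ := by
        simpa using norm_add_le (gradient g x) (gradient g y - gradient g x)
      have h4 := mul_le_mul_of_nonneg_left h2 hL
      linarith
    have hpt : ∀ ξ, inner ℝ (gradient (fun y => G y ξ) y) e ^ 2
        ≤ ‖e‖ ^ 2 * (2 * ‖gradient (fun y => G y ξ) y - gradient g y‖ ^ 2 + 2 * B ^ 2) :=
      fun ξ => by
        set z := gradient (fun y => G y ξ) y
        have h1 : inner ℝ z e ^ 2 ≤ (‖z‖ * ‖e‖) ^ 2 := by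
          rw [← sq_abs]
          gcongr
          exact abs_real_inner_le_norm z e
        have h2 : ‖z‖ ≤ ‖z - gradient g y‖ + B := by
          have := norm_add_le (z - gradient g y) (gradient g y)
          rw [sub_add_cancel] at this
          linarith
        have h3 : ‖z‖ ^ 2 ≤ (‖z - gradient g y‖ + B) ^ 2 := by gcongr
        have h4 : ‖z‖ ^ 2 ≤ 2 * ‖z - gradient g y‖ ^ 2 + 2 * B ^ 2 := by
          nlinarith [sq_nonneg (‖z - gradient g y‖ - B)]
        calc _ ≤ ‖e‖ ^ 2 * ‖z‖ ^ 2 := by rw [← mul_pow, mul_comm ‖e‖]; exact h1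
          _ ≤ _ := by gcongr
    have hint2 : Integrable (fun ξ =>
        ‖e‖ ^ 2 * (2 * ‖gradient (fun y => G y ξ) y - gradient g y‖ ^ 2 + 2 * B ^ 2)) μ :=
      (((hσ y).1.const_mul 2).add (integrable_const _)).const_mul _
    calc _ ≤ ∫⁻ ξ, ENNReal.ofReal (‖e‖ ^ 2 *
            (2 * ‖gradient (fun y => G y ξ) y - gradient g y‖ ^ 2 + 2 * B ^ 2)) ∂μ :=
          lintegral_mono fun ξ => ENNReal.ofReal_le_ofReal (hpt ξ)
      _ = ENNReal.ofReal (∫ ξ, ‖e‖ ^ 2 *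
            (2 * ‖gradient (fun y => G y ξ) y - gradient g y‖ ^ 2 + 2 * B ^ 2) ∂μ) :=
          (ofReal_integral_eq_lintegral_ofReal hint2 (ae_of_all _ fun ξ => by positivity)).symm
      _ ≤ _ := by
          refine ENNReal.ofReal_le_ofReal ?_
          rw [integral_const_mul, integral_add ((hσ y).1.const_mul 2) (integrable_const _),
            integral_const_mul]
          have := (hσ y).2
          simp only [integral_const, probReal_univ, smul_eq_mul, one_mul]
          gcongr
  set C := ‖e‖ ^ 2 * (2 * σ ^ 2 + 2 * B ^ 2) with hC
  have hC0 : 0 ≤ C := by positivity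
  have hline : ∀ ξ, Measurable fun s : ℝ => inner ℝ (gradient (fun y => G y ξ) (x + s • e)) e :=
    fun ξ => by
      have : Measurable fun s : ℝ => ((x + s • e, ξ) : Model n m × Ξ) := by fun_prop
      exact (hgm.comp this).inner_const
  have hjoint : Measurable fun z : ℝ × Ξ =>
      inner ℝ (gradient (fun y => G y z.2) (x + z.1 • e)) e := by
    have : Measurable fun z : ℝ × Ξ => ((x + z.1 • e, z.2) : Model n m × Ξ) := by fun_prop
    exact (hgm.comp this).inner_const
  -- The squared quotient is at most the mean over the segment of the squared directional
  -- derivative; Tonelli then moves the expectation inside, where the uniform bound applies.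
  have hΔsq : ∀ k, ∫⁻ ξ, ENNReal.ofReal (diffQuotient (fun y => G y ξ) x e k ^ 2) ∂μ
      ≤ ENNReal.ofReal C := by
    intro k
    set h : ℝ := 1 / ((k : ℝ) + 1) with hh
    have hpos : 0 < h := by positivity
    have hle : h ≤ 1 := by
      rw [hh, div_le_one (by positivity)]
      have : (0 : ℝ) ≤ k := by positivity
      linarith
    have hpt : ∀ ξ, ENNReal.ofReal (diffQuotient (fun y => G y ξ) x e k ^ 2)
        ≤ ENNReal.ofReal (h⁻¹) * ∫⁻ s in Set.Ioc 0 h,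
          ENNReal.ofReal (inner ℝ (gradient (fun y => G y ξ) (x + s • e)) e ^ 2) := fun ξ => by
      have h1 := ofReal_sq_sub_le_lintegral hpos
        (hasDerivAt_comp_line (hdiff ξ) x e) (hline ξ)
      have h2 : diffQuotient (fun y => G y ξ) x e k ^ 2
          = h⁻¹ ^ 2 * (G (x + h • e) ξ - G (x + (0 : ℝ) • e) ξ) ^ 2 := by
        rw [← mul_pow, diffQuotient, zero_smul, add_zero, hh, one_div, inv_inv]
      rw [h2, ENNReal.ofReal_mul (by positivity)]
      refine (mul_le_mul_right h1 _).trans_eq ?_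
      rw [← mul_assoc, ← ENNReal.ofReal_mul (by positivity)]
      congr 2
      field_simp
    calc _ ≤ ∫⁻ ξ, (ENNReal.ofReal (h⁻¹) * ∫⁻ s in Set.Ioc 0 h,
          ENNReal.ofReal (inner ℝ (gradient (fun y => G y ξ) (x + s • e)) e ^ 2)) ∂μ :=
          lintegral_mono hpt
      _ = ENNReal.ofReal (h⁻¹) * ∫⁻ s in Set.Ioc 0 h, (∫⁻ ξ,
          ENNReal.ofReal (inner ℝ (gradient (fun y => G y ξ) (x + s • e)) e ^ 2) ∂μ) := by
          rw [lintegral_const_mul' _ _ ENNReal.ofReal_ne_top]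
          congr 1
          refine lintegral_lintegral_swap (f := fun ξ s =>
            ENNReal.ofReal (inner ℝ (gradient (fun y => G y ξ) (x + s • e)) e ^ 2)) ?_
          exact ((hjoint.comp measurable_swap).pow_const 2).ennreal_ofReal.aemeasurable
      _ ≤ ENNReal.ofReal (h⁻¹) * ∫⁻ _ in Set.Ioc 0 h, ENNReal.ofReal C := by
          gcongr ENNReal.ofReal (h⁻¹) * ?_
          refine setLIntegral_mono measurable_const fun s hs => hsq s ⟨hs.1.le, hs.2.trans hle⟩
      _ = ENNReal.ofReal C := by
          rw [setLIntegral_const, Real.volume_Ioc, sub_zero, mul_left_comm,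
            ← ENNReal.ofReal_mul (by positivity), inv_mul_cancel₀ hpos.ne']
          simp
  have hmeasΔ : ∀ k, Measurable fun ξ => diffQuotient (fun y => G y ξ) x e k := fun k => by
    have h1 : ∀ y, Measurable fun ξ => G y ξ := fun y =>
      hmeas.comp (measurable_const.prodMk measurable_id)
    exact ((h1 _).sub (h1 _)).const_mul _
  have hbound : ∀ φ : Ξ → ℝ, Measurable φ →
      ∫⁻ ξ, ENNReal.ofReal (φ ξ ^ 2) ∂μ ≤ ENNReal.ofReal C →
      MemLp φ 2 μ ∧ ∫ ξ, φ ξ ^ 2 ∂μ ≤ C := fun φ hφ hle => by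
    have hφi : Integrable (fun ξ => φ ξ ^ 2) μ := by
      refine ⟨(hφ.pow_const 2).aestronglyMeasurable, ?_⟩
      rw [hasFiniteIntegral_iff_ofReal (ae_of_all _ fun s => sq_nonneg _)]
      exact hle.trans_lt ENNReal.ofReal_lt_top
    refine ⟨(memLp_two_iff_integrable_sq hφ.aestronglyMeasurable).2 hφi, ?_⟩
    rw [← ofReal_integral_eq_lintegral_ofReal hφi (ae_of_all _ fun s => sq_nonneg _)] at hle
    exact (ENNReal.ofReal_le_ofReal_iff hC0).1 hle
  have h0 := hsq 0 ⟨le_rfl, zero_le_one⟩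
  simp only [zero_smul, add_zero] at h0
  obtain ⟨hδ, hδC⟩ := hbound _ ((hgx x).inner_const (c := e)) h0
  have hlim := tendsto_integral_of_sq_bound (fun k => (hbound _ (hmeasΔ k) (hΔsq k)).1) hδ
    (fun k => (hbound _ (hmeasΔ k) (hΔsq k)).2) hδC
    (fun ξ => tendsto_diffQuotient (hdiff ξ) x e)
  -- The expected difference quotients are those of `g`, so they also converge to the directional
  -- derivative of `g`; the two limits agree.
  refine tendsto_nhds_unique hlim ((tendsto_diffQuotient hg x e).congr fun k => ?_)
  simp only [diffQuotient, hgdef]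
  rw [integral_const_mul, integral_sub (hint _) (hint _)]

end Parametric

end Unbiased

/-! ### Smoothness -/

/-- The descent inequality for functions with a Lipschitz gradient. -/
theorem le_add_inner_add_of_lipschitz_gradient {E : Type*} [NormedAddCommGroup E]
    [InnerProductSpace ℝ E] [CompleteSpace E] {g : E → ℝ} (hg : Differentiable ℝ g) {L : ℝ}
    (hLip : ∀ x y, ‖gradient g x - gradient g y‖ ≤ L * ‖x - y‖) (x y : E) :
    g y ≤ g x + inner ℝ (gradient g x) (y - x) + L / 2 * ‖y - x‖ ^ 2 := by
  set e := y - x with he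
  have hd : ∀ s : ℝ, HasDerivAt
      (fun s : ℝ => g (x + s • e) - s * inner ℝ (gradient g x) e - s ^ 2 * (L / 2 * ‖e‖ ^ 2))
      (inner ℝ (gradient g (x + s • e)) e - inner ℝ (gradient g x) e - s * (L * ‖e‖ ^ 2)) s :=
    fun s => by
      have h := ((hasDerivAt_comp_line hg x e s).sub
        ((hasDerivAt_id s).mul_const (inner ℝ (gradient g x) e))).sub
        ((hasDerivAt_pow 2 s).mul_const (L / 2 * ‖e‖ ^ 2))
      refine h.congr_deriv ?_
      simp
      ring
  -- By the Lipschitz bound on the gradient the derivative just computed is nonpositive; comparing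
  -- the endpoints `0` and `1` is the claim.
  have hanti : AntitoneOn
      (fun s : ℝ => g (x + s • e) - s * inner ℝ (gradient g x) e - s ^ 2 * (L / 2 * ‖e‖ ^ 2))
      (Set.Icc 0 1) := by
    refine antitoneOn_of_deriv_nonpos (convex_Icc 0 1)
      (fun s _ => (hd s).continuousAt.continuousWithinAt)
      (fun s _ => (hd s).differentiableAt.differentiableWithinAt) fun s hs => ?_
    rw [interior_Icc] at hs
    rw [(hd s).deriv, ← inner_sub_left]
    have h1 := hLip (x + s • e) x
    rw [add_sub_cancel_left, norm_smul, Real.norm_of_nonneg hs.1.le] at h1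
    have h2 := real_inner_le_norm (gradient g (x + s • e) - gradient g x) e
    have h3 := mul_le_mul_of_nonneg_right h1 (norm_nonneg e)
    nlinarith
  have h := hanti (Set.left_mem_Icc.2 zero_le_one) (Set.right_mem_Icc.2 zero_le_one) zero_le_one
  simp only [zero_smul, add_zero, one_smul] at h
  have hxy : x + e = y := by rw [he]; abel
  rw [hxy] at h
  linarith

/-! ### Independent mean-zero perturbations -/

section Noise

theorem integrable_norm_sq_of_memLp {Ω E : Type*} [MeasurableSpace Ω] {P : Measure Ω}
    [NormedAddCommGroup E] {f : Ω → E} (hf : MemLp f 2 P) :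
    Integrable (fun ω => ‖f ω‖ ^ 2) P :=
  (memLp_two_iff_integrable_sq_norm hf.1).1 hf

theorem integral_norm_sq_const_add {Ω E : Type*} [MeasurableSpace Ω] {P : Measure Ω}
    [IsProbabilityMeasure P] [NormedAddCommGroup E] [InnerProductSpace ℝ E] [CompleteSpace E]
    {Z : Ω → E} (hZ : MemLp Z 2 P) (h0 : ∫ ω, Z ω ∂P = 0) (a : E) :
    ∫ ω, ‖a + Z ω‖ ^ 2 ∂P = ‖a‖ ^ 2 + ∫ ω, ‖Z ω‖ ^ 2 ∂P := by
  have hi : Integrable Z P := hZ.integrable (by norm_num)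
  have h2 : Integrable (fun ω => 2 * inner ℝ a (Z ω)) P := (hi.const_inner a).const_mul 2
  have h1 : Integrable (fun ω => ‖a‖ ^ 2 + 2 * inner ℝ a (Z ω)) P := (integrable_const _).add h2
  simp_rw [norm_add_sq_real]
  rw [integral_add h1 (integrable_norm_sq_of_memLp hZ), integral_add (integrable_const _) h2,
    integral_const_mul, integral_inner hi, h0]
  simp

variable {n m : ℕ} {Ξ : Fin n → Type*} [∀ i, MeasurableSpace (Ξ i)]
  {D : ∀ i, Measure (Ξ i)} [∀ i, IsProbabilityMeasure (D i)]

/-- In each coordinate, variances of independent variables add, and mean zero turns variances into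
second moments. This is the source of the factor `1 / n` on the noise of the average. -/
theorem integral_norm_sq_sum_pi {Z : ∀ i, Ξ i → Model n m} (hZ : ∀ i, MemLp (Z i) 2 (D i))
    (h0 : ∀ i, ∫ ξ, Z i ξ ∂(D i) = 0) :
    ∫ ξ, ‖∑ i, Z i (ξ i)‖ ^ 2 ∂(Measure.pi D) = ∑ i, ∫ ξ, ‖Z i ξ‖ ^ 2 ∂(D i) := by
  have hc : ∀ i jk, MemLp (fun ξ => Z i ξ jk) 2 (D i) := fun i jk => (hZ i).eval_piLp jk
  have hc0 : ∀ i jk, ∫ ξ, Z i ξ jk ∂(D i) = 0 := fun i jk => by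
    rw [← eval_integral_piLp fun jk => (hc i jk).integrable (by norm_num), h0]
    rfl
  have hp : ∀ i jk, MemLp (fun ξ : ∀ i, Ξ i => Z i (ξ i) jk) 2 (Measure.pi D) := fun i jk =>
    (hc i jk).comp_measurePreserving (measurePreserving_eval D i)
  have hps : ∀ jk, MemLp (fun ξ : ∀ i, Ξ i => ∑ i, Z i (ξ i) jk) 2 (Measure.pi D) := fun jk =>
    memLp_finsetSum _ fun i _ => hp i jk
  have hvar : ∀ jk, ∫ ξ, (∑ i, Z i (ξ i) jk) ^ 2 ∂(Measure.pi D)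
      = ∑ i, ∫ ξ, Z i ξ jk ^ 2 ∂(D i) := fun jk => by
    have h1 := variance_sum_pi (fun i => hc i jk)
    have h2 : (∑ i, fun ω : ∀ i, Ξ i => Z i (ω i) jk) = fun ω => ∑ i, Z i (ω i) jk := by
      ext ω; simp
    rw [h2, variance_of_integral_eq_zero (hps jk).1.aemeasurable] at h1
    · rw [h1]
      exact Finset.sum_congr rfl fun i _ =>
        variance_of_integral_eq_zero (hc i jk).1.aemeasurable (hc0 i jk)
    · rw [integral_finsetSum _ fun i _ => (hp i jk).integrable (by norm_num)]
      refine Finset.sum_eq_zero fun i _ => ?_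
      rw [integral_comp_eval (f := fun ξ => Z i ξ jk) (hc i jk).1, hc0]
  simp_rw [EuclideanSpace.real_norm_sq_eq]
  have hsum : ∀ (ξ : ∀ i, Ξ i) jk, (∑ i, Z i (ξ i)) jk = ∑ i, Z i (ξ i) jk := fun ξ jk => by simp
  simp_rw [hsum]
  rw [integral_finsetSum _ fun jk _ => (hps jk).integrable_sq]
  simp_rw [hvar]
  rw [Finset.sum_comm]
  exact Finset.sum_congr rfl fun i _ =>
    (integral_finsetSum _ fun jk _ => (hc i jk).integrable_sq).symm

end Noise

/-! ### Square integrability of averages and deviations -/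

section SquareIntegrable

variable {n m : ℕ}

theorem memLp_average {Ω : Type*} [MeasurableSpace Ω] {P : Measure Ω} {Z : Ω → Fin n → Model n m}
    (hZ : ∀ i, MemLp (fun ω => Z ω i) 2 P) : MemLp (fun ω => average (Z ω)) 2 P :=
  (memLp_finsetSum (Finset.univ : Finset (Fin n)) fun i _ => hZ i).const_smul (1 / (n : ℝ))

theorem integrable_deviation {Ω : Type*} [MeasurableSpace Ω] {P : Measure Ω}
    {Z : Ω → Fin n → Model n m} (hZ : ∀ i, MemLp (fun ω => Z ω i) 2 P) :
    Integrable (fun ω => deviation (Z ω)) P :=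
  integrable_finsetSum _ fun i _ => integrable_norm_sq_of_memLp ((hZ i).sub (memLp_average hZ))

end SquareIntegrable

/-! ### The assumptions on the losses -/

section Losses

variable {n m : ℕ} {Ξ : Fin n → Type*} [∀ i, MeasurableSpace (Ξ i)]

/-- Measurable, differentiable losses with Lipschitz gradients, stochastic gradients of bounded
variance, and local gradients of bounded diversity. -/
structure IsRegularLoss (D : ∀ i, Measure (Ξ i)) (F : ∀ i, Model n m → Ξ i → ℝ)
    (L σ ζ : ℝ) : Prop where
  measurable : ∀ i, Measurable (Function.uncurry (F i))
  integrable : ∀ i x, Integrable (F i x) (D i)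
  differentiable : ∀ i ξ, Differentiable ℝ (fun x => F i x ξ)
  differentiable_localLoss : ∀ i, Differentiable ℝ (localLoss D F i)
  nonneg : 0 ≤ L
  lipschitz : ∀ i x y, ‖gradient (localLoss D F i) x - gradient (localLoss D F i) y‖
      ≤ L * ‖x - y‖
  variance : ∀ i x,
      Integrable (fun ξ => ‖stochGradient F i x ξ - gradient (localLoss D F i) x‖ ^ 2) (D i) ∧
      ∫ ξ, ‖stochGradient F i x ξ - gradient (localLoss D F i) x‖ ^ 2 ∂(D i) ≤ σ ^ 2
  diversity : ∀ x, (1 / (n : ℝ)) *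
      ∑ i, ‖gradient (localLoss D F i) x - gradient (globalLoss D F) x‖ ^ 2 ≤ ζ ^ 2

variable {D : ∀ i, Measure (Ξ i)} {F : ∀ i, Model n m → Ξ i → ℝ} {L σ ζ : ℝ}

namespace IsRegularLoss

theorem hasGradientAt_globalLoss (h : IsRegularLoss D F L σ ζ) (x : Model n m) :
    HasGradientAt (globalLoss D F) (averageGradient D F fun _ => x) x := by
  rw [hasGradientAt_iff_hasFDerivAt]
  have h1 : ∀ i, HasFDerivAt (localLoss D F i)
      (InnerProductSpace.toDual ℝ _ (gradient (localLoss D F i) x)) x := fun i =>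
    (h.differentiable_localLoss i x).hasGradientAt.hasFDerivAt
  have h2 := (HasFDerivAt.fun_sum (u := Finset.univ) fun i _ => h1 i).const_mul (1 / (n : ℝ))
  refine h2.congr_fderiv ?_
  simp [averageGradient, average]

theorem gradient_globalLoss (h : IsRegularLoss D F L σ ζ) (x : Model n m) :
    gradient (globalLoss D F) x = averageGradient D F fun _ => x :=
  (h.hasGradientAt_globalLoss x).gradient

theorem differentiable_globalLoss (h : IsRegularLoss D F L σ ζ) :
    Differentiable ℝ (globalLoss D F) := fun x => (h.hasGradientAt_globalLoss x).differentiableAt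

theorem norm_sq_averageGradient_sub_le (h : IsRegularLoss D F L σ ζ) (x y : Fin n → Model n m) :
    n * ‖averageGradient D F x - averageGradient D F y‖ ^ 2 ≤ L ^ 2 * ∑ i, ‖x i - y i‖ ^ 2 := by
  rw [averageGradient, averageGradient, ← average_sub]
  refine (norm_average_sq_le _).trans ?_
  rw [Finset.mul_sum]
  refine Finset.sum_le_sum fun i _ => ?_
  rw [← mul_pow]
  gcongr
  exact h.lipschitz i _ _

theorem lipschitz_globalLoss (h : IsRegularLoss D F L σ ζ) (x y : Model n m) :
    ‖gradient (globalLoss D F) x - gradient (globalLoss D F) y‖ ≤ L * ‖x - y‖ := by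
  rcases Nat.eq_zero_or_pos n with rfl | hn
  · have : x = y := by ext jk; exact jk.1.elim0
    simp [this]
  have hn' : (0 : ℝ) < n := by exact_mod_cast hn
  have h1 := h.norm_sq_averageGradient_sub_le (fun _ => x) fun _ => y
  rw [← h.gradient_globalLoss, ← h.gradient_globalLoss] at h1
  simp only [Finset.sum_const, Finset.card_univ, Fintype.card_fin, nsmul_eq_mul] at h1
  have hL := h.nonneg
  refine le_of_sq_le_sq ?_ (by positivity)
  rw [mul_pow]
  refine le_of_mul_le_mul_left ?_ hn'
  linarith

theorem descent (h : IsRegularLoss D F L σ ζ) (x y : Model n m) :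
    globalLoss D F y ≤ globalLoss D F x + inner ℝ (gradient (globalLoss D F) x) (y - x)
      + L / 2 * ‖y - x‖ ^ 2 :=
  le_add_inner_add_of_lipschitz_gradient h.differentiable_globalLoss h.lipschitz_globalLoss x y

theorem norm_sq_gradient_sub_averageGradient_le (h : IsRegularLoss D F L σ ζ)
    (x : Fin n → Model n m) :
    n * ‖gradient (globalLoss D F) (average x) - averageGradient D F x‖ ^ 2
      ≤ L ^ 2 * deviation x := by
  rw [h.gradient_globalLoss, norm_sub_rev]
  exact h.norm_sq_averageGradient_sub_le _ _

/-- The average minimizes the sum of squared distances, so it may be replaced by the global gradient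
at the average model. Each difference then splits into a Lipschitz part and a diversity part. -/
theorem deviation_gradient_le (h : IsRegularLoss D F L σ ζ) (x : Fin n → Model n m) :
    deviation (fun i => gradient (localLoss D F i) (x i))
      ≤ 2 * L ^ 2 * deviation x + 2 * n * ζ ^ 2 := by
  rcases Nat.eq_zero_or_pos n with rfl | hn
  · simp [deviation]
  have hn' : (0 : ℝ) < n := by exact_mod_cast hn
  refine (deviation_le _ (gradient (globalLoss D F) (average x))).trans ?_
  have hd := h.diversity (average x)
  rw [one_div, inv_mul_le_iff₀ hn'] at hd
  have hpt : ∀ i, ‖gradient (localLoss D F i) (x i) - gradient (globalLoss D F) (average x)‖ ^ 2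
      ≤ 2 * L ^ 2 * ‖x i - average x‖ ^ 2
        + 2 * ‖gradient (localLoss D F i) (average x)
          - gradient (globalLoss D F) (average x)‖ ^ 2 := fun i => by
    set a := gradient (localLoss D F i) (x i) - gradient (localLoss D F i) (average x)
    set b := gradient (localLoss D F i) (average x) - gradient (globalLoss D F) (average x)
    have hab : gradient (localLoss D F i) (x i) - gradient (globalLoss D F) (average x) = a + b := by
      simp [a, b]
    rw [hab]
    have ha : ‖a‖ ≤ L * ‖x i - average x‖ := h.lipschitz i _ _
    have ha2 : ‖a‖ ^ 2 ≤ (L * ‖x i - average x‖) ^ 2 := by gcongr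
    have h1 : ‖a + b‖ ^ 2 ≤ (‖a‖ + ‖b‖) ^ 2 := by gcongr; exact norm_add_le a b
    nlinarith [sq_nonneg (‖a‖ - ‖b‖)]
  refine (Finset.sum_le_sum fun i _ => hpt i).trans ?_
  rw [Finset.sum_add_distrib, ← Finset.mul_sum, ← Finset.mul_sum, deviation]
  linarith

theorem measurable_stochGradient (h : IsRegularLoss D F L σ ζ) (i : Fin n) :
    Measurable (fun z : Model n m × Ξ i => stochGradient F i z.1 z.2) :=
  measurable_gradient_uncurry (h.measurable i) (h.differentiable i)

theorem continuous_gradient (h : IsRegularLoss D F L σ ζ) (i : Fin n) :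
    Continuous (gradient (localLoss D F i)) :=
  (LipschitzWith.of_dist_le_mul (K := ⟨L, h.nonneg⟩) fun x y => by
    rw [dist_eq_norm, dist_eq_norm]; exact h.lipschitz i x y).continuous

theorem continuous_gradient_globalLoss (h : IsRegularLoss D F L σ ζ) :
    Continuous (gradient (globalLoss D F)) :=
  (LipschitzWith.of_dist_le_mul (K := ⟨L, h.nonneg⟩) fun x y => by
    rw [dist_eq_norm, dist_eq_norm]; exact h.lipschitz_globalLoss x y).continuous

theorem average_stochGradient_eq (x : Fin n → Model n m) (ξ : ∀ i, Ξ i) :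
    average (fun i => stochGradient F i (x i) (ξ i)) = averageGradient D F x
      + (1 / (n : ℝ)) • ∑ i, (stochGradient F i (x i) (ξ i) - gradient (localLoss D F i) (x i)) := by
  have := average_add (fun i => gradient (localLoss D F i) (x i))
    fun i => stochGradient F i (x i) (ξ i) - gradient (localLoss D F i) (x i)
  simp only [add_sub_cancel] at this
  rw [this]
  rfl

theorem memLp_noise (h : IsRegularLoss D F L σ ζ) (i : Fin n) (x : Model n m) :
    MemLp (fun ξ => stochGradient F i x ξ - gradient (localLoss D F i) x) 2 (D i) := by
  refine (memLp_two_iff_integrable_sq_norm ?_).2 (h.variance i x).1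
  exact (((h.measurable_stochGradient i).comp
    (measurable_const.prodMk measurable_id)).sub_const _).aestronglyMeasurable

/-! ### Moments of the stochastic gradients -/

variable [∀ i, IsProbabilityMeasure (D i)]

theorem integral_noise (h : IsRegularLoss D F L σ ζ) (i : Fin n) (x : Model n m) :
    ∫ ξ, (stochGradient F i x ξ - gradient (localLoss D F i) x) ∂(D i) = 0 := by
  obtain ⟨h1, h2⟩ := integral_gradient_eq (h.measurable i) (h.integrable i) (h.differentiable i)
    (h.differentiable_localLoss i) (h.lipschitz i) (h.variance i) h.nonneg x
  have h3 : ∫ ξ, stochGradient F i x ξ ∂(D i) = gradient (localLoss D F i) x := h2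
  rw [integral_sub (show Integrable (stochGradient F i x) (D i) from h1) (integrable_const _), h3]
  simp

theorem memLp_stochGradient (h : IsRegularLoss D F L σ ζ) (x : Fin n → Model n m) (i : Fin n) :
    MemLp (fun ξ : ∀ i, Ξ i => stochGradient F i (x i) (ξ i)) 2 (Measure.pi D) := by
  have h1 := (h.memLp_noise i (x i)).comp_measurePreserving (measurePreserving_eval D i)
  have h2 := h1.add (memLp_const (gradient (localLoss D F i) (x i)))
  refine h2.congr_norm ?_ (ae_of_all _ fun ξ => by simp)
  exact ((h.measurable_stochGradient i).comp
    (measurable_const.prodMk (measurable_pi_apply i))).aestronglyMeasurable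

theorem memLp_pi_noise (h : IsRegularLoss D F L σ ζ) (x : Fin n → Model n m) (i : Fin n) :
    MemLp (fun ξ : ∀ i, Ξ i => stochGradient F i (x i) (ξ i) - gradient (localLoss D F i) (x i)) 2
      (Measure.pi D) :=
  (h.memLp_stochGradient x i).sub (memLp_const _)

theorem integral_pi_noise (h : IsRegularLoss D F L σ ζ) (x : Fin n → Model n m) (i : Fin n) :
    ∫ ξ : ∀ i, Ξ i, (stochGradient F i (x i) (ξ i) - gradient (localLoss D F i) (x i))
      ∂(Measure.pi D) = 0 := by
  rw [integral_comp_eval (f := fun ξ => stochGradient F i (x i) ξ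
    - gradient (localLoss D F i) (x i)) (h.memLp_noise i (x i)).1, h.integral_noise]

theorem integral_average_stochGradient (h : IsRegularLoss D F L σ ζ) (x : Fin n → Model n m) :
    ∫ ξ : ∀ i, Ξ i, average (fun i => stochGradient F i (x i) (ξ i)) ∂(Measure.pi D)
      = averageGradient D F x := by
  have hi : ∀ i, Integrable (fun ξ : ∀ i, Ξ i => stochGradient F i (x i) (ξ i)) (Measure.pi D) :=
    fun i => (h.memLp_stochGradient x i).integrable (by norm_num)
  have he : ∀ i, ∫ ξ : ∀ i, Ξ i, stochGradient F i (x i) (ξ i) ∂(Measure.pi D)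
      = gradient (localLoss D F i) (x i) := fun i => by
    have := h.integral_pi_noise x i
    rw [integral_sub (hi i) (integrable_const _)] at this
    simpa [sub_eq_zero] using this
  simp only [average, averageGradient]
  rw [integral_smul, integral_finsetSum _ fun i _ => hi i]
  simp_rw [he]

/-- The second moment of the averaged stochastic gradient. -/
theorem integral_norm_sq_average_stochGradient (h : IsRegularLoss D F L σ ζ)
    (x : Fin n → Model n m) :
    ∫ ξ : ∀ i, Ξ i, ‖average (fun i => stochGradient F i (x i) (ξ i))‖ ^ 2 ∂(Measure.pi D)
      = ‖averageGradient D F x‖ ^ 2 + (1 / (n : ℝ)) ^ 2 *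
        ∑ i, ∫ ξ, ‖stochGradient F i (x i) ξ - gradient (localLoss D F i) (x i)‖ ^ 2 ∂(D i) := by
  simp_rw [average_stochGradient_eq (D := D) x]
  have hsum : MemLp (fun ξ : ∀ i, Ξ i => (1 / (n : ℝ)) •
      ∑ i, (stochGradient F i (x i) (ξ i) - gradient (localLoss D F i) (x i))) 2 (Measure.pi D) :=
    (memLp_finsetSum Finset.univ fun i _ => h.memLp_pi_noise x i).const_smul (1 / (n : ℝ))
  rw [integral_norm_sq_const_add hsum]
  · congr 1
    simp_rw [norm_smul, mul_pow, Real.norm_eq_abs, sq_abs]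
    rw [integral_const_mul, integral_norm_sq_sum_pi (fun i => h.memLp_noise i (x i))
      (fun i => h.integral_noise i (x i))]
  · rw [integral_smul, integral_finsetSum _ fun i _ =>
      (h.memLp_pi_noise x i).integrable (by norm_num)]
    simp_rw [h.integral_pi_noise]
    simp

theorem integral_norm_sq_average_stochGradient_le (h : IsRegularLoss D F L σ ζ)
    (x : Fin n → Model n m) :
    ∫ ξ : ∀ i, Ξ i, ‖average (fun i => stochGradient F i (x i) (ξ i))‖ ^ 2 ∂(Measure.pi D)
      ≤ ‖averageGradient D F x‖ ^ 2 + σ ^ 2 / n := by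
  rw [h.integral_norm_sq_average_stochGradient]
  gcongr
  have h1 := Finset.sum_le_sum fun i (_ : i ∈ Finset.univ) => (h.variance i (x i)).2
  simp only [Finset.sum_const, Finset.card_univ, Fintype.card_fin, nsmul_eq_mul] at h1
  calc _ ≤ (1 / (n : ℝ)) ^ 2 * (n * σ ^ 2) := by gcongr
    _ = σ ^ 2 / n := by
      rcases eq_or_ne (n : ℝ) 0 with h0 | h0
      · simp [h0]
      · field_simp

theorem integral_deviation_stochGradient_le (h : IsRegularLoss D F L σ ζ)
    (x : Fin n → Model n m) :
    ∫ ξ : ∀ i, Ξ i, deviation (fun i => stochGradient F i (x i) (ξ i)) ∂(Measure.pi D)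
      ≤ n * (σ ^ 2 + 3 * ζ ^ 2) + 6 * L ^ 2 * deviation x := by
  have hmem := h.memLp_stochGradient x
  have hvar : ∀ i, ∫ ξ : ∀ i, Ξ i, ‖stochGradient F i (x i) (ξ i)‖ ^ 2 ∂(Measure.pi D)
      ≤ ‖gradient (localLoss D F i) (x i)‖ ^ 2 + σ ^ 2 := fun i => by
    rw [integral_comp_eval (f := fun ξ => ‖stochGradient F i (x i) ξ‖ ^ 2)]
    · have h1 := integral_norm_sq_const_add (h.memLp_noise i (x i)) (h.integral_noise i (x i))
        (gradient (localLoss D F i) (x i))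
      simp only [add_sub_cancel] at h1
      rw [h1]
      gcongr
      exact (h.variance i (x i)).2
    · exact (((h.measurable_stochGradient i).comp
        (measurable_const.prodMk measurable_id)).norm.pow_const 2).aestronglyMeasurable
  have havg : ‖averageGradient D F x‖ ^ 2
      ≤ ∫ ξ : ∀ i, Ξ i, ‖average (fun i => stochGradient F i (x i) (ξ i))‖ ^ 2 ∂(Measure.pi D) := by
    rw [h.integral_norm_sq_average_stochGradient]
    have : 0 ≤ (1 / (n : ℝ)) ^ 2 *
        ∑ i, ∫ ξ, ‖stochGradient F i (x i) ξ - gradient (localLoss D F i) (x i)‖ ^ 2 ∂(D i) :=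
      mul_nonneg (by positivity)
        (Finset.sum_nonneg fun i _ => integral_nonneg fun ξ => by positivity)
    linarith
  simp_rw [deviation_eq (fun i => stochGradient F i (x i) _)]
  rw [integral_sub (integrable_finsetSum _ fun i _ => integrable_norm_sq_of_memLp (hmem i))
      ((integrable_norm_sq_of_memLp (memLp_average hmem)).const_mul _),
    integral_finsetSum _ fun i _ => integrable_norm_sq_of_memLp (hmem i), integral_const_mul]
  have h1 := Finset.sum_le_sum fun i (_ : i ∈ Finset.univ) => hvar i
  simp only [Finset.sum_add_distrib, Finset.sum_const, Finset.card_univ, Fintype.card_fin,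
    nsmul_eq_mul] at h1
  have h2 := mul_le_mul_of_nonneg_left havg (Nat.cast_nonneg (α := ℝ) n)
  have h3 := h.deviation_gradient_le x
  rw [deviation_eq] at h3
  have h4 : averageGradient D F x = average fun i => gradient (localLoss D F i) (x i) := rfl
  rw [h4] at h2
  -- The estimates give the coefficients `2` for both `L ^ 2 * deviation x` and `n * ζ ^ 2`; they
  -- are relaxed to the `6` and `3` of the theorem.
  have h5 : 0 ≤ L ^ 2 * deviation x := mul_nonneg (sq_nonneg _) (deviation_nonneg x)
  have h6 : 0 ≤ n * ζ ^ 2 := by positivity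
  linarith

end IsRegularLoss

end Losses

/-! ### One iteration -/

section OneStep

/-- The local models after the stochastic gradient steps of one iteration, before the
communication. -/
def gradientStep {n m : ℕ} {Ξ : Fin n → Type*} (F : ∀ i, Model n m → Ξ i → ℝ)
    (γ : ℝ) (x : Fin n → Model n m)
    (ξ : ∀ i, Ξ i) : Fin n → Model n m :=
  fun i => x i - γ • stochGradient F i (x i) (ξ i)

theorem average_gradientStep {n m : ℕ} {Ξ : Fin n → Type*} (F : ∀ i, Model n m → Ξ i → ℝ) (γ : ℝ)
    (x : Fin n → Model n m) (ξ : ∀ i, Ξ i) :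
    average (gradientStep F γ x ξ)
      = average x - γ • average fun i => stochGradient F i (x i) (ξ i) := by
  rw [← average_smul, ← average_sub]
  rfl

variable {n m : ℕ} {Ξ : Fin n → Type*} [∀ i, MeasurableSpace (Ξ i)]

theorem measurable_communicate :
    Measurable fun z : Net n × (Fin n → Model n m) => communicate z.1 z.2 := by
  refine measurable_from_prod_countable_right fun s => ?_
  refine measurable_pi_lambda _ fun c => ?_
  refine (WithLp.measurable_toLp 2 _).comp (measurable_pi_lambda _ fun jk => ?_)
  have h : Measurable fun v : Fin n → Model n m => communicate s v c jk := by
    simp_rw [communicate_apply, Matrix.vecMul, dotProduct]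
    refine Finset.measurable_fun_sum Finset.univ fun a _ => ?_
    have : Measurable fun v : Fin n → Model n m => v a jk := by fun_prop
    exact this.mul_const _
  exact h

variable {D : ∀ i, Measure (Ξ i)} {F : ∀ i, Model n m → Ξ i → ℝ} {L σ ζ γ : ℝ}
  {p : unitInterval}

instance roundLaw_isProbabilityMeasure (D : ∀ i, Measure (Ξ i)) [∀ i, IsProbabilityMeasure (D i)]
    (p : unitInterval) : IsProbabilityMeasure (roundLaw D p) := by
  unfold roundLaw; infer_instance

theorem integral_roundLaw [∀ i, IsProbabilityMeasure (D i)]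
    {f : (∀ i, Ξ i) × Net n → ℝ} (hf : Integrable f (roundLaw D p)) :
    ∫ y, f y ∂(roundLaw D p) = ∫ ξ, ∫ s, f (ξ, s) ∂(netLaw n p) ∂(Measure.pi D) :=
  integral_prod f hf

theorem memLp_of_sq_le_sum {Ω : Type*} [MeasurableSpace Ω] {P : Measure Ω}
    {Z : Ω → Fin n → Model n m} (hZ : ∀ i, MemLp (fun ω => Z ω i) 2 P) {f : Ω → Model n m}
    (hf : AEStronglyMeasurable f P) (hle : ∀ ω, ‖f ω‖ ^ 2 ≤ ∑ i, ‖Z ω i‖ ^ 2) : MemLp f 2 P := by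
  refine (memLp_two_iff_integrable_sq_norm hf).2 ?_
  refine (integrable_finsetSum Finset.univ fun i _ => integrable_norm_sq_of_memLp (hZ i)).mono'
    (hf.norm.pow 2) (ae_of_all _ fun ω => ?_)
  rw [Real.norm_of_nonneg (by positivity)]
  exact hle ω

namespace IsRegularLoss

theorem measurable_step (h : IsRegularLoss D F L σ ζ) (γ : ℝ) :
    Measurable fun z : (Fin n → Model n m) × ((∀ i, Ξ i) × Net n) => step F γ z.1 z.2 := by
  refine measurable_communicate.comp (measurable_snd.snd.prodMk (measurable_pi_lambda _ fun i => ?_))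
  have h1 : Measurable fun z : (Fin n → Model n m) × ((∀ i, Ξ i) × Net n) => z.1 i :=
    (measurable_pi_apply i).comp measurable_fst
  have h2 : Measurable fun z : (Fin n → Model n m) × ((∀ i, Ξ i) × Net n) => z.2.1 i :=
    (measurable_pi_apply i).comp measurable_snd.fst
  exact h1.sub (((h.measurable_stochGradient i).comp (h1.prodMk h2)).const_smul γ)

variable [∀ i, IsProbabilityMeasure (D i)]

theorem memLp_gradientStep (h : IsRegularLoss D F L σ ζ) (γ : ℝ) (x : Fin n → Model n m)
    (i : Fin n) : MemLp (fun ξ => gradientStep F γ x ξ i) 2 (Measure.pi D) :=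
  (memLp_const (x i)).sub ((h.memLp_stochGradient x i).const_smul γ)

theorem memLp_step_const (h : IsRegularLoss D F L σ ζ) (γ : ℝ) (x : Fin n → Model n m)
    (c : Fin n) : MemLp (fun y => step F γ x y c) 2 (roundLaw D p) := by
  have hv : ∀ i, MemLp (fun y : (∀ i, Ξ i) × Net n => gradientStep F γ x y.1 i) 2 (roundLaw D p) :=
    fun i => (h.memLp_gradientStep γ x i).comp_measurePreserving measurePreserving_fst
  refine memLp_of_sq_le_sum hv ?_ fun y => norm_sq_communicate_le _ _ _
  exact ((measurable_pi_apply c).comp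
    ((h.measurable_step γ).comp (measurable_const.prodMk measurable_id))).aestronglyMeasurable

theorem integral_deviation_step (h : IsRegularLoss D F L σ ζ) {α₁ α₂ : ℝ}
    (hα : IsMixingPair n p α₁ α₂) (γ : ℝ) (x : Fin n → Model n m) :
    ∫ y, deviation (step F γ x y) ∂(roundLaw D p)
      = (α₁ - α₂) * ∫ ξ, deviation (gradientStep F γ x ξ) ∂(Measure.pi D) := by
  rw [integral_roundLaw (integrable_deviation (h.memLp_step_const γ x)), ← integral_const_mul]
  congr with ξ
  exact hα.integral_deviation_communicate (gradientStep F γ x ξ)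

theorem integral_norm_sq_average_step_sub (h : IsRegularLoss D F L σ ζ) {α₁ α₂ : ℝ}
    (hα : IsMixingPair n p α₁ α₂) (γ : ℝ) (x : Fin n → Model n m) (w : Model n m) :
    n * ∫ y, ‖average (step F γ x y) - w‖ ^ 2 ∂(roundLaw D p)
      = n * ∫ ξ, ‖average (gradientStep F γ x ξ) - w‖ ^ 2 ∂(Measure.pi D)
        + α₂ * ∫ ξ, deviation (gradientStep F γ x ξ) ∂(Measure.pi D) := by
  have hs : MemLp (fun y => average (step F γ x y) - w) 2 (roundLaw D p) :=
    (memLp_average (h.memLp_step_const γ x)).sub (memLp_const w)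
  have hg : MemLp (fun ξ => average (gradientStep F γ x ξ) - w) 2 (Measure.pi D) :=
    (memLp_average (h.memLp_gradientStep γ x)).sub (memLp_const w)
  have hd := integrable_deviation (h.memLp_gradientStep γ x)
  rw [← integral_const_mul, integral_roundLaw ((integrable_norm_sq_of_memLp hs).const_mul _),
    ← integral_const_mul, ← integral_const_mul,
    ← integral_add ((integrable_norm_sq_of_memLp hg).const_mul _) (hd.const_mul _)]
  congr with ξ
  exact hα.integral_norm_sq_average_communicate_sub (gradientStep F γ x ξ) w

theorem integral_inner_average_step (h : IsRegularLoss D F L σ ζ) (γ : ℝ)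
    (x : Fin n → Model n m) (w : Model n m) :
    ∫ y, inner ℝ w (average (step F γ x y) - average x) ∂(roundLaw D p)
      = -γ * inner ℝ w (averageGradient D F x) := by
  have hs : Integrable (fun y => average (step F γ x y) - average x) (roundLaw D p) :=
    ((memLp_average (h.memLp_step_const (p := p) γ x)).sub (memLp_const _)).integrable
      (by norm_num)
  have hG : Integrable (fun ξ : ∀ i, Ξ i => average fun i => stochGradient F i (x i) (ξ i))
      (Measure.pi D) := (memLp_average (h.memLp_stochGradient x)).integrable (by norm_num)
  rw [integral_roundLaw (hs.const_inner w)]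
  have h1 : ∀ ξ, ∫ s, inner ℝ w (average (step F γ x (ξ, s)) - average x) ∂(netLaw n p)
      = -γ * inner ℝ w (average fun i => stochGradient F i (x i) (ξ i)) := fun ξ => by
    simp_rw [inner_sub_right]
    rw [integral_sub (integrable_netLaw p _) (integrable_const _)]
    have h2 : ∫ s, inner ℝ w (average (step F γ x (ξ, s))) ∂(netLaw n p)
        = inner ℝ w (average (gradientStep F γ x ξ)) :=
      integral_inner_average_communicate (gradientStep F γ x ξ) w
    rw [h2, average_gradientStep, inner_sub_right, inner_smul_right]
    simp
  simp_rw [h1]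
  rw [integral_const_mul, integral_inner hG, h.integral_average_stochGradient]

/-- The weights stay free because two choices are needed: one with factor `β` for the contraction,
and `(q, a, b) = (1, 2, 2)` for the descent. -/
theorem mul_integral_deviation_gradientStep_le (h : IsRegularLoss D F L σ ζ) (γ : ℝ)
    (x : Fin n → Model n m) {a b q : ℝ}
    (hab : ∀ s t : ℝ, q * (s + t) ^ 2 ≤ a * s ^ 2 + b * t ^ 2) (hq : 0 ≤ q) (hb : 0 ≤ b) :
    q * ∫ ξ, deviation (gradientStep F γ x ξ) ∂(Measure.pi D) ≤ a * deviation x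
      + b * γ ^ 2 * (n * (σ ^ 2 + 3 * ζ ^ 2) + 6 * L ^ 2 * deviation x) := by
  have hd := integrable_deviation (h.memLp_gradientStep γ x)
  have hG : Integrable (fun ξ : ∀ i, Ξ i => deviation fun i => stochGradient F i (x i) (ξ i))
      (Measure.pi D) := integrable_deviation (h.memLp_stochGradient x)
  rw [← integral_const_mul]
  calc _ ≤ ∫ ξ : ∀ i, Ξ i, (a * deviation x
            + b * γ ^ 2 * deviation fun i => stochGradient F i (x i) (ξ i)) ∂(Measure.pi D) :=
        integral_mono (hd.const_mul q) ((integrable_const _).add (hG.const_mul _))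
          fun ξ => deviation_sub_smul_le x _ γ hab hq
    _ = a * deviation x + b * γ ^ 2 *
          ∫ ξ : ∀ i, Ξ i, deviation (fun i => stochGradient F i (x i) (ξ i)) ∂(Measure.pi D) := by
        rw [integral_add (integrable_const _) (hG.const_mul _), integral_const,
          integral_const_mul]
        simp
    _ ≤ _ := by
        gcongr
        exact h.integral_deviation_stochGradient_le x

theorem integral_norm_sq_average_gradientStep_sub_le (h : IsRegularLoss D F L σ ζ) (γ : ℝ)
    (x : Fin n → Model n m) :
    ∫ ξ, ‖average (gradientStep F γ x ξ) - average x‖ ^ 2 ∂(Measure.pi D)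
      ≤ γ ^ 2 * (‖averageGradient D F x‖ ^ 2 + σ ^ 2 / n) := by
  have h1 : ∀ ξ : ∀ i, Ξ i, ‖average (gradientStep F γ x ξ) - average x‖ ^ 2
      = γ ^ 2 * ‖average fun i => stochGradient F i (x i) (ξ i)‖ ^ 2 := fun ξ => by
    rw [average_gradientStep, sub_sub_cancel_left, norm_neg, norm_smul, mul_pow, Real.norm_eq_abs,
      sq_abs]
  simp_rw [h1]
  rw [integral_const_mul]
  gcongr
  exact h.integral_norm_sq_average_stochGradient_le x

/-- The contraction of the deviation in one iteration. -/
theorem integral_deviation_step_le (h : IsRegularLoss D F L σ ζ) {α₁ α₂ : ℝ}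
    (hα : IsMixingPair n p α₁ α₂) (γ : ℝ) (x : Fin n → Model n m) {q : ℝ} (hq : 0 ≤ q)
    (hq1 : q < 1) (hqα : q ^ 2 = α₁ - α₂) :
    ∫ y, deviation (step F γ x y) ∂(roundLaw D p) ≤ q * deviation x
      + q ^ 2 / (1 - q) * γ ^ 2 * (n * (σ ^ 2 + 3 * ζ ^ 2) + 6 * L ^ 2 * deviation x) := by
  rw [h.integral_deviation_step hα, ← hqα]
  have hq' : 0 < 1 - q := by linarith
  refine h.mul_integral_deviation_gradientStep_le γ x (fun s t => ?_) (sq_nonneg q)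
    (by positivity)
  -- Young's inequality with weights `q` and `1 - q`, multiplied by `q ^ 2` so that `q = 0` is
  -- allowed.
  have : q * s ^ 2 + q ^ 2 / (1 - q) * t ^ 2 - q ^ 2 * (s + t) ^ 2
      = q * ((1 - q) * s - q * t) ^ 2 / (1 - q) := by
    field_simp
    ring
  have h2 : 0 ≤ q * ((1 - q) * s - q * t) ^ 2 / (1 - q) := by positivity
  linarith

/-- The expected descent in one iteration. -/
theorem integral_globalLoss_step_le (h : IsRegularLoss D F L σ ζ) {α₁ α₂ : ℝ}
    (hα : IsMixingPair n p α₁ α₂) (hn : 0 < n) (hγ : 0 < γ) (x : Fin n → Model n m)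
    (hint : Integrable (fun y => globalLoss D F (average (step F γ x y))) (roundLaw D p)) :
    ∫ y, globalLoss D F (average (step F γ x y)) ∂(roundLaw D p)
      ≤ globalLoss D F (average x)
        - γ / 2 * (‖gradient (globalLoss D F) (average x)‖ ^ 2
          + (1 - L * γ) * ‖averageGradient D F x‖ ^ 2)
        + γ / 2 * (L ^ 2 / n * deviation x) + L / 2 * (γ ^ 2 * (σ ^ 2 / n))
        + L * α₂ / n * (deviation x
          + γ ^ 2 * (n * (σ ^ 2 + 3 * ζ ^ 2) + 6 * L ^ 2 * deviation x)) := by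
  have hn' : (0 : ℝ) < n := by exact_mod_cast hn
  have hL := h.nonneg
  set w := gradient (globalLoss D F) (average x) with hw
  have hs := (memLp_average (h.memLp_step_const (p := p) γ x)).sub (memLp_const (average x))
  have hsi : Integrable (fun y => inner ℝ w (average (step F γ x y) - average x)) (roundLaw D p) :=
    (hs.integrable (by norm_num)).const_inner w
  have hs2 : Integrable (fun y => L / 2 * ‖average (step F γ x y) - average x‖ ^ 2)
      (roundLaw D p) := (integrable_norm_sq_of_memLp hs).const_mul _
  have h1 : ∫ y, globalLoss D F (average (step F γ x y)) ∂(roundLaw D p)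
      ≤ globalLoss D F (average x) + -γ * inner ℝ w (averageGradient D F x)
        + L / 2 * ∫ y, ‖average (step F γ x y) - average x‖ ^ 2 ∂(roundLaw D p) := by
    have h0 : Integrable (fun y => globalLoss D F (average x)
        + inner ℝ w (average (step F γ x y) - average x)) (roundLaw D p) :=
      (integrable_const _).add hsi
    refine (integral_mono hint (h0.add hs2) fun y =>
      h.descent (average x) (average (step F γ x y))).trans_eq ?_
    simp only [Pi.add_apply]
    rw [integral_add h0 hs2, integral_add (integrable_const _) hsi,
      h.integral_inner_average_step, integral_const_mul]
    simp
  have h2 := h.integral_norm_sq_average_step_sub hα γ x (average x)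
  have h3 := h.integral_norm_sq_average_gradientStep_sub_le γ x
  have h4 := h.mul_integral_deviation_gradientStep_le γ x (a := 2) (b := 2) (q := 1)
    (fun s t => by nlinarith [sq_nonneg (s - t)]) zero_le_one zero_le_two
  rw [one_mul] at h4
  set S := ∫ y, ‖average (step F γ x y) - average x‖ ^ 2 ∂(roundLaw D p)
  set I := ∫ ξ, ‖average (gradientStep F γ x ξ) - average x‖ ^ 2 ∂(Measure.pi D)
  set J := ∫ ξ, deviation (gradientStep F γ x ξ) ∂(Measure.pi D)
  -- Expanding this square replaces the inner product in the descent bound by the two squared norms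
  -- of the theorem, at the cost of a multiple of the deviation.
  have h5 := h.norm_sq_gradient_sub_averageGradient_le x
  rw [← hw, norm_sub_sq_real] at h5
  set N := ‖w‖ ^ 2
  set M := ‖averageGradient D F x‖ ^ 2
  set B := n * (σ ^ 2 + 3 * ζ ^ 2) + 6 * L ^ 2 * deviation x
  have h6 : S ≤ γ ^ 2 * (M + σ ^ 2 / n) + α₂ / n * (2 * deviation x + 2 * γ ^ 2 * B) := by
    have : S = I + α₂ / n * J := by field_simp; linarith
    rw [this]
    have hα0 := hα.nonneg
    gcongr
  have h7 : N - 2 * inner ℝ w (averageGradient D F x) + M ≤ L ^ 2 / n * deviation x := by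
    rw [div_mul_eq_mul_div, le_div_iff₀ hn']
    linarith
  have h8 := mul_le_mul_of_nonneg_left h6 (by positivity : 0 ≤ L / 2)
  have h9 := mul_le_mul_of_nonneg_left h7 (by positivity : 0 ≤ γ / 2)
  have h10 : L / 2 * (γ ^ 2 * (M + σ ^ 2 / n) + α₂ / n * (2 * deviation x + 2 * γ ^ 2 * B))
      = L / 2 * γ ^ 2 * M + L / 2 * (γ ^ 2 * (σ ^ 2 / n))
        + L * α₂ / n * (deviation x + γ ^ 2 * B) := by ring
  rw [h10] at h8
  linarith

end IsRegularLoss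

end OneStep

/-! ### The trajectory -/

section Trajectory

variable {n m : ℕ}

theorem continuous_average : Continuous fun x : Fin n → Model n m => average x := by
  unfold average
  fun_prop

theorem continuous_deviation : Continuous fun x : Fin n → Model n m => deviation x := by
  unfold deviation
  have := continuous_average (n := n) (m := m)
  fun_prop

/-- Square integrability is preserved by maps of linear growth. -/
theorem memLp_comp_of_lipschitz {Ω E E' : Type*} [MeasurableSpace Ω] {P : Measure Ω}
    [IsProbabilityMeasure P] [NormedAddCommGroup E] [NormedAddCommGroup E'] {g : E → E'}
    (hg : Continuous g) {L : ℝ} (hLip : ∀ x y, ‖g x - g y‖ ≤ L * ‖x - y‖) {Z : Ω → E}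
    (hZ : MemLp Z 2 P) : MemLp (fun ω => g (Z ω)) 2 P := by
  have h1 : MemLp (fun ω => L * ‖Z ω‖ + ‖g 0‖) 2 P :=
    (hZ.norm.const_mul L).add (memLp_const _)
  refine h1.of_le (hg.comp_aestronglyMeasurable hZ.1) (ae_of_all _ fun ω => ?_)
  have h2 := hLip (Z ω) 0
  rw [sub_zero] at h2
  have h3 := norm_add_le (g (Z ω) - g 0) (g 0)
  rw [sub_add_cancel] at h3
  exact (h3.trans (add_le_add_left h2 _)).trans (le_abs_self _)

variable {Ξ : Fin n → Type*} [∀ i, MeasurableSpace (Ξ i)]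
  {D : ∀ i, Measure (Ξ i)} {F : ∀ i, Model n m → Ξ i → ℝ} {L σ ζ γ : ℝ} {p : unitInterval}

/-- The joint law of independent variables is the product of their laws. -/
theorem map_prodMk_of_indepFun {Ω : Type*} [MeasurableSpace Ω] {P : Measure Ω} [IsProbabilityMeasure P]
    {S R : Type*} [MeasurableSpace S] [MeasurableSpace R] {μ : Measure R} {X : Ω → S} {Y : Ω → R}
    (hX : Measurable X) (hY : Measurable Y) (hXY : IndepFun X Y P) (hlaw : P.map Y = μ) :
    P.map (fun ω => (X ω, Y ω)) = (P.map X).prod μ := by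
  rw [← hlaw]
  exact hXY.map_prod_eq_prod_map_map hX.aemeasurable hY.aemeasurable

/-- Conditioning on `X` in the form of Fubini: a bound for every frozen value of `X` survives
averaging over `X`. -/
theorem integral_le_of_indep {Ω : Type*} [MeasurableSpace Ω] {P : Measure Ω}
    [IsProbabilityMeasure P] {S R : Type*} [MeasurableSpace S] [MeasurableSpace R] {μ : Measure R}
    [IsProbabilityMeasure μ] {X : Ω → S} {Y : Ω → R}
    (hX : Measurable X) (hY : Measurable Y) (hXY : IndepFun X Y P) (hlaw : P.map Y = μ)
    {H : S × R → ℝ} (hH : Measurable H) (hHint : Integrable (fun ω => H (X ω, Y ω)) P)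
    {K : S → ℝ} (hK : Measurable K) (hKint : Integrable (fun ω => K (X ω)) P)
    (hle : ∀ x, ∫ y, H (x, y) ∂μ ≤ K x) :
    ∫ ω, H (X ω, Y ω) ∂P ≤ ∫ ω, K (X ω) ∂P := by
  have hmap := map_prodMk_of_indepFun hX hY hXY hlaw
  have hXY' : Measurable fun ω => (X ω, Y ω) := hX.prodMk hY
  have := Measure.isProbabilityMeasure_map (μ := P) hX.aemeasurable
  have h1 : Integrable H ((P.map X).prod μ) := by
    rw [← hmap]
    exact (integrable_map_measure hH.aestronglyMeasurable hXY'.aemeasurable).2 hHint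
  have h2 : Integrable K (P.map X) :=
    (integrable_map_measure hK.aestronglyMeasurable hX.aemeasurable).2 hKint
  calc ∫ ω, H (X ω, Y ω) ∂P = ∫ z, H z ∂((P.map X).prod μ) := by
        rw [← hmap, integral_map hXY'.aemeasurable hH.aestronglyMeasurable]
    _ = ∫ x, ∫ y, H (x, y) ∂μ ∂(P.map X) := integral_prod H h1
    _ ≤ ∫ x, K x ∂(P.map X) := integral_mono h1.integral_prod_left h2 hle
    _ = ∫ ω, K (X ω) ∂P := integral_map hX.aemeasurable hK.aestronglyMeasurable

/-- The bound `C` is uniform in the frozen value, so no moment of `X` is required. -/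
theorem integrable_of_indep {Ω : Type*} [MeasurableSpace Ω] {P : Measure Ω}
    [IsProbabilityMeasure P] {S R : Type*} [MeasurableSpace S] [MeasurableSpace R] {μ : Measure R}
    [IsProbabilityMeasure μ] {X : Ω → S} {Y : Ω → R}
    (hX : Measurable X) (hY : Measurable Y) (hXY : IndepFun X Y P) (hlaw : P.map Y = μ)
    {H : S × R → ℝ} (hH : Measurable H) (h0 : ∀ z, 0 ≤ H z) {C : ℝ}
    (hle : ∀ x, Integrable (fun y => H (x, y)) μ ∧ ∫ y, H (x, y) ∂μ ≤ C) :
    Integrable (fun ω => H (X ω, Y ω)) P := by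
  have hmap := map_prodMk_of_indepFun hX hY hXY hlaw
  have hXY' : Measurable fun ω => (X ω, Y ω) := hX.prodMk hY
  have := Measure.isProbabilityMeasure_map (μ := P) hX.aemeasurable
  refine (integrable_map_measure hH.aestronglyMeasurable hXY'.aemeasurable).1 ?_
  rw [hmap, integrable_prod_iff hH.aestronglyMeasurable]
  refine ⟨ae_of_all _ fun x => (hle x).1, ?_⟩
  refine (integrable_const C).mono' (hH.aestronglyMeasurable.norm.integral_prod_right')
    (ae_of_all _ fun x => ?_)
  rw [Real.norm_of_nonneg (integral_nonneg fun y => norm_nonneg _)]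
  simp_rw [Real.norm_of_nonneg (h0 _)]
  exact (hle x).2

namespace IsRegularLoss

theorem continuous_averageGradient (h : IsRegularLoss D F L σ ζ) :
    Continuous (averageGradient D F) :=
  continuous_average.comp (continuous_pi fun i =>
    (h.continuous_gradient i).comp (continuous_apply i))

/-- The models before iteration `t` depend measurably on the rounds with index below `t` alone.
Hence they are independent of round `t`. -/
theorem exists_iterate_eq (h : IsRegularLoss D F L σ ζ) (γ : ℝ) (t : ℕ) :
    ∃ Φ : (Finset.range t → (∀ i, Ξ i) × Net n) → Fin n → Model n m, Measurable Φ ∧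
      ∀ y, iterate F γ y t = Φ fun r => y r := by
  induction t with
  | zero => exact ⟨fun _ _ => 0, measurable_const, fun _ => rfl⟩
  | succ t ih =>
    obtain ⟨Φ, hΦ, heq⟩ := ih
    refine ⟨fun w => step F γ
      (Φ fun r => w ⟨r, Finset.range_subset_range.2 (Nat.le_succ t) r.2⟩)
      (w ⟨t, Finset.self_mem_range_succ t⟩), ?_, fun y => ?_⟩
    · exact (h.measurable_step γ).comp ((hΦ.comp (measurable_pi_lambda _ fun r =>
        measurable_pi_apply _)).prodMk (measurable_pi_apply _))
    · rw [iterate, heq]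

section

variable {Ω : Type*} [MeasurableSpace Ω] {P : Measure Ω} {Y : ℕ → Ω → (∀ i, Ξ i) × Net n}

theorem measurable_iterate (h : IsRegularLoss D F L σ ζ) (hY : IsIIDSample P (roundLaw D p) Y)
    (γ : ℝ) (t : ℕ) : Measurable fun ω => iterate F γ (fun r => Y r ω) t := by
  obtain ⟨Φ, hΦ, heq⟩ := h.exists_iterate_eq γ t
  simp_rw [heq]
  exact hΦ.comp (measurable_pi_lambda _ fun r => hY.measurable r)

theorem indepFun_iterate (h : IsRegularLoss D F L σ ζ) (hY : IsIIDSample P (roundLaw D p) Y)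
    (γ : ℝ) (t : ℕ) : IndepFun (fun ω => iterate F γ (fun r => Y r ω) t) (Y t) P := by
  obtain ⟨Φ, hΦ, heq⟩ := h.exists_iterate_eq γ t
  simp_rw [heq]
  have h1 := hY.indep.indepFun_finset (Finset.range t) {t} (by simp) hY.measurable
  exact h1.comp hΦ (measurable_pi_apply (⟨t, Finset.mem_singleton_self t⟩ : ({t} : Finset ℕ)))

variable [IsProbabilityMeasure P]

/-- The loss lies between its lower bound and the quadratic upper bound given by the descent
inequality at the origin. -/
theorem integrable_globalLoss (h : IsRegularLoss D F L σ ζ)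
    (hbdd : BddBelow (Set.range (globalLoss D F))) {Z : Ω → Model n m} (hZ : MemLp Z 2 P) :
    Integrable (fun ω => globalLoss D F (Z ω)) P := by
  obtain ⟨c, hc⟩ := hbdd
  have hL := h.nonneg
  have hb : Integrable (fun ω => |c| + |globalLoss D F 0|
      + ‖gradient (globalLoss D F) 0‖ * ‖Z ω‖ + L / 2 * ‖Z ω‖ ^ 2) P :=
    ((integrable_const _).add ((hZ.integrable (by norm_num)).norm.const_mul _)).add
      ((integrable_norm_sq_of_memLp hZ).const_mul _)
  refine hb.mono' (h.differentiable_globalLoss.continuous.comp_aestronglyMeasurable hZ.1)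
    (ae_of_all _ fun ω => ?_)
  have h1 := h.descent 0 (Z ω)
  rw [sub_zero] at h1
  have h2 := real_inner_le_norm (gradient (globalLoss D F) 0) (Z ω)
  have h3 : c ≤ globalLoss D F (Z ω) := hc ⟨Z ω, rfl⟩
  have h4 : 0 ≤ ‖gradient (globalLoss D F) 0‖ * ‖Z ω‖ := by positivity
  have h5 : 0 ≤ L / 2 * ‖Z ω‖ ^ 2 := by positivity
  rw [Real.norm_eq_abs, abs_le]
  constructor
  · linarith [neg_abs_le c, abs_nonneg (globalLoss D F 0)]
  · linarith [le_abs_self (globalLoss D F 0), abs_nonneg c]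

theorem integrable_norm_sq_gradient (h : IsRegularLoss D F L σ ζ) {Z : Ω → Fin n → Model n m}
    (hZ : ∀ i, MemLp (fun ω => Z ω i) 2 P) :
    Integrable (fun ω => ‖gradient (globalLoss D F) (average (Z ω))‖ ^ 2) P :=
  integrable_norm_sq_of_memLp (memLp_comp_of_lipschitz h.continuous_gradient_globalLoss
    h.lipschitz_globalLoss (memLp_average hZ))

theorem integrable_norm_sq_averageGradient (h : IsRegularLoss D F L σ ζ)
    {Z : Ω → Fin n → Model n m} (hZ : ∀ i, MemLp (fun ω => Z ω i) 2 P) :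
    Integrable (fun ω => ‖averageGradient D F (Z ω)‖ ^ 2) P :=
  integrable_norm_sq_of_memLp (memLp_average fun i =>
    memLp_comp_of_lipschitz (h.continuous_gradient i) (h.lipschitz i) (hZ i))

variable [∀ i, IsProbabilityMeasure (D i)]

/-- The noise has second moment at most `σ ^ 2` for every frozen model, and the exact gradient grows
at most linearly; their sum is the stochastic gradient at the random model. -/
theorem memLp_step_of_indep (h : IsRegularLoss D F L σ ζ) (γ : ℝ)
    {X : Ω → Fin n → Model n m} {R : Ω → (∀ i, Ξ i) × Net n}
    (hX : Measurable X) (hR : Measurable R) (hXR : IndepFun X R P)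
    (hlaw : P.map R = roundLaw D p) (hX2 : ∀ i, MemLp (fun ω => X ω i) 2 P) (c : Fin n) :
    MemLp (fun ω => step F γ (X ω) (R ω) c) 2 P := by
  have hG : ∀ i, MemLp (fun ω => stochGradient F i (X ω i) ((R ω).1 i)) 2 P := fun i => by
    have hx : Measurable fun z : (Fin n → Model n m) × ((∀ i, Ξ i) × Net n) => z.1 i :=
      (measurable_pi_apply i).comp measurable_fst
    have hξ : Measurable fun z : (Fin n → Model n m) × ((∀ i, Ξ i) × Net n) => z.2.1 i :=
      (measurable_pi_apply i).comp measurable_snd.fst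
    have hm : Measurable fun z : (Fin n → Model n m) × ((∀ i, Ξ i) × Net n) =>
        stochGradient F i (z.1 i) (z.2.1 i) - gradient (localLoss D F i) (z.1 i) :=
      ((h.measurable_stochGradient i).comp (hx.prodMk hξ)).sub
        ((h.continuous_gradient i).measurable.comp hx)
    have hi := integrable_of_indep hX hR hXR hlaw (hm.norm.pow_const 2)
      (fun z => by positivity) (C := σ ^ 2) fun x => by
        have hmp : MeasurePreserving (fun y : (∀ i, Ξ i) × Net n => y.1) (roundLaw D p)
          (Measure.pi D) := measurePreserving_fst
        have hn := (integrable_norm_sq_of_memLp (h.memLp_pi_noise x i))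
        have hi : Integrable (fun y : (∀ i, Ξ i) × Net n =>
            ‖stochGradient F i (x i) (y.1 i) - gradient (localLoss D F i) (x i)‖ ^ 2)
            (roundLaw D p) := (hmp.integrable_comp hn.1).2 hn
        refine ⟨hi, ?_⟩
        rw [integral_roundLaw hi]
        simp only [integral_const, probReal_univ, one_smul]
        rw [integral_comp_eval (f := fun ξ =>
          ‖stochGradient F i (x i) ξ - gradient (localLoss D F i) (x i)‖ ^ 2)
          (h.variance i (x i)).1.1]
        exact (h.variance i (x i)).2
    have hm2 := hm.comp (hX.prodMk hR)
    have h1 : MemLp (fun ω => stochGradient F i (X ω i) ((R ω).1 i)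
        - gradient (localLoss D F i) (X ω i)) 2 P :=
      (memLp_two_iff_integrable_sq_norm hm2.aestronglyMeasurable).2 hi
    have h2 := memLp_comp_of_lipschitz (h.continuous_gradient i) (h.lipschitz i) (hX2 i)
    refine (h1.add h2).congr_norm ?_ (ae_of_all _ fun ω => by simp)
    exact ((h.measurable_stochGradient i).comp
      ((hx.prodMk hξ).comp (hX.prodMk hR))).aestronglyMeasurable
  have hv : ∀ i, MemLp (fun ω => gradientStep F γ (X ω) (R ω).1 i) 2 P := fun i =>
    (hX2 i).sub ((hG i).const_smul γ)
  refine memLp_of_sq_le_sum hv ?_ fun ω => norm_sq_communicate_le _ _ _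
  exact ((measurable_pi_apply c).comp
    ((h.measurable_step γ).comp (hX.prodMk hR))).aestronglyMeasurable

theorem memLp_iterate (h : IsRegularLoss D F L σ ζ) (hY : IsIIDSample P (roundLaw D p) Y)
    (γ : ℝ) (t : ℕ) (i : Fin n) : MemLp (fun ω => iterate F γ (fun r => Y r ω) t i) 2 P := by
  induction t generalizing i with
  | zero => exact memLp_const 0
  | succ t ih =>
    exact h.memLp_step_of_indep γ (h.measurable_iterate hY γ t) (hY.measurable t)
      (h.indepFun_iterate hY γ t) (hY.law t) ih i

/-! ### Expected recursions along the trajectory -/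

theorem integral_deviation_iterate_succ_le (h : IsRegularLoss D F L σ ζ)
    (hY : IsIIDSample P (roundLaw D p) Y) {α₁ α₂ : ℝ} (hα : IsMixingPair n p α₁ α₂) (γ : ℝ)
    {q : ℝ} (hq : 0 ≤ q) (hq1 : q < 1) (hqα : q ^ 2 = α₁ - α₂) (t : ℕ) :
    ∫ ω, deviation (iterate F γ (fun r => Y r ω) (t + 1)) ∂P
      ≤ q * ∫ ω, deviation (iterate F γ (fun r => Y r ω) t) ∂P
        + q ^ 2 / (1 - q) * γ ^ 2 * (n * (σ ^ 2 + 3 * ζ ^ 2)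
          + 6 * L ^ 2 * ∫ ω, deviation (iterate F γ (fun r => Y r ω) t) ∂P) := by
  have hd : ∀ t, Integrable (fun ω => deviation (iterate F γ (fun r => Y r ω) t)) P := fun t =>
    integrable_deviation (h.memLp_iterate hY γ t)
  have hB : Integrable (fun ω => n * (σ ^ 2 + 3 * ζ ^ 2)
      + 6 * L ^ 2 * deviation (iterate F γ (fun r => Y r ω) t)) P :=
    (integrable_const _).add ((hd t).const_mul _)
  have hdm := (continuous_deviation (n := n) (m := m)).measurable
  have key := integral_le_of_indep (h.measurable_iterate hY γ t) (hY.measurable t)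
    (h.indepFun_iterate hY γ t) (hY.law t)
    (H := fun z => deviation (step F γ z.1 z.2)) (hdm.comp (h.measurable_step γ)) (hd (t + 1))
    (K := fun x => q * deviation x
      + q ^ 2 / (1 - q) * γ ^ 2 * (n * (σ ^ 2 + 3 * ζ ^ 2) + 6 * L ^ 2 * deviation x))
    (by fun_prop) (((hd t).const_mul _).add (hB.const_mul _))
    (fun x => h.integral_deviation_step_le hα γ x hq hq1 hqα)
  refine key.trans_eq ?_
  rw [integral_add ((hd t).const_mul _) (hB.const_mul _), integral_const_mul, integral_const_mul,
    integral_add (integrable_const _) ((hd t).const_mul _), integral_const, integral_const_mul]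
  simp

theorem integral_globalLoss_iterate_succ_le (h : IsRegularLoss D F L σ ζ)
    (hbdd : BddBelow (Set.range (globalLoss D F)))
    (hY : IsIIDSample P (roundLaw D p) Y) {α₁ α₂ : ℝ} (hα : IsMixingPair n p α₁ α₂)
    (hn : 0 < n) (hγ : 0 < γ) (t : ℕ) :
    ∫ ω, globalLoss D F (average (iterate F γ (fun r => Y r ω) (t + 1))) ∂P
      ≤ ∫ ω, globalLoss D F (average (iterate F γ (fun r => Y r ω) t)) ∂P
        - γ / 2 * (∫ ω, ‖gradient (globalLoss D F)
            (average (iterate F γ (fun r => Y r ω) t))‖ ^ 2 ∂P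
          + (1 - L * γ) * ∫ ω, ‖averageGradient D F (iterate F γ (fun r => Y r ω) t)‖ ^ 2 ∂P)
        + γ / 2 * (L ^ 2 / n * ∫ ω, deviation (iterate F γ (fun r => Y r ω) t) ∂P)
        + L / 2 * (γ ^ 2 * (σ ^ 2 / n))
        + L * α₂ / n * (∫ ω, deviation (iterate F γ (fun r => Y r ω) t) ∂P
          + γ ^ 2 * (n * (σ ^ 2 + 3 * ζ ^ 2)
            + 6 * L ^ 2 * ∫ ω, deviation (iterate F γ (fun r => Y r ω) t) ∂P)) := by
  have hmem := h.memLp_iterate hY γ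
  have hd := integrable_deviation (hmem t)
  have hN := h.integrable_norm_sq_gradient (hmem t)
  have hM := h.integrable_norm_sq_averageGradient (hmem t)
  have hf : ∀ t, Integrable
      (fun ω => globalLoss D F (average (iterate F γ (fun r => Y r ω) t))) P := fun t =>
    h.integrable_globalLoss hbdd (memLp_average (hmem t))
  have hdm := (continuous_deviation (n := n) (m := m)).measurable
  have ham := (continuous_average (n := n) (m := m)).measurable
  have hfm := h.differentiable_globalLoss.continuous.measurable
  have hgm := h.continuous_gradient_globalLoss.measurable
  have hMm := h.continuous_averageGradient.measurable
  have e1 : Integrable (fun ω => γ / 2 * (‖gradient (globalLoss D F)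
      (average (iterate F γ (fun r => Y r ω) t))‖ ^ 2
      + (1 - L * γ) * ‖averageGradient D F (iterate F γ (fun r => Y r ω) t)‖ ^ 2)) P :=
    (hN.add (hM.const_mul _)).const_mul _
  have e2 : Integrable (fun ω =>
      γ / 2 * (L ^ 2 / n * deviation (iterate F γ (fun r => Y r ω) t))) P :=
    (hd.const_mul _).const_mul _
  have e3 : Integrable (fun ω => γ ^ 2 * (n * (σ ^ 2 + 3 * ζ ^ 2)
      + 6 * L ^ 2 * deviation (iterate F γ (fun r => Y r ω) t))) P :=
    ((integrable_const _).add (hd.const_mul _)).const_mul _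
  have e4 : Integrable (fun ω => L * α₂ / n * (deviation (iterate F γ (fun r => Y r ω) t)
      + γ ^ 2 * (n * (σ ^ 2 + 3 * ζ ^ 2)
        + 6 * L ^ 2 * deviation (iterate F γ (fun r => Y r ω) t)))) P :=
    (hd.add e3).const_mul _
  have key := integral_le_of_indep (h.measurable_iterate hY γ t) (hY.measurable t)
    (h.indepFun_iterate hY γ t) (hY.law t)
    (H := fun z => globalLoss D F (average (step F γ z.1 z.2)))
    (hfm.comp (ham.comp (h.measurable_step γ))) (hf (t + 1))
    (K := fun x => globalLoss D F (average x)
        - γ / 2 * (‖gradient (globalLoss D F) (average x)‖ ^ 2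
          + (1 - L * γ) * ‖averageGradient D F x‖ ^ 2)
        + γ / 2 * (L ^ 2 / n * deviation x) + L / 2 * (γ ^ 2 * (σ ^ 2 / n))
        + L * α₂ / n * (deviation x
          + γ ^ 2 * (n * (σ ^ 2 + 3 * ζ ^ 2) + 6 * L ^ 2 * deviation x)))
    (by fun_prop)
    (((((hf t).sub e1).add e2).add (integrable_const _)).add e4)
    (fun x => h.integral_globalLoss_step_le hα hn hγ x
      (h.integrable_globalLoss hbdd (memLp_average (h.memLp_step_const γ x))))
  refine key.trans_eq ?_
  have s1 : Integrable (fun ω => globalLoss D F (average (iterate F γ (fun r => Y r ω) t))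
      - γ / 2 * (‖gradient (globalLoss D F) (average (iterate F γ (fun r => Y r ω) t))‖ ^ 2
      + (1 - L * γ) * ‖averageGradient D F (iterate F γ (fun r => Y r ω) t)‖ ^ 2)) P :=
    (hf t).sub e1
  have s2 := s1.add e2
  have s3 := s2.add (integrable_const (L / 2 * (γ ^ 2 * (σ ^ 2 / n))))
  refine (integral_add s3 e4).trans ?_
  refine (congrArg (· + _) ((integral_add s2 (integrable_const _)).trans
    (congrArg (· + _) (integral_add s1 e2)))).trans ?_
  rw [integral_const, integral_sub (hf t) e1, integral_const_mul,
    integral_add hN (hM.const_mul _), integral_const_mul, integral_const_mul, integral_const_mul,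
    integral_const_mul, integral_add hd e3, integral_const_mul,
    integral_add (integrable_const _) (hd.const_mul _), integral_const, integral_const_mul]
  simp

end

end IsRegularLoss

end Trajectory

/-! ### Summation of the recursions -/

/-- Summation of a contractive recursion. -/
theorem sum_le_of_contraction {δ : ℕ → ℝ} {q c B K : ℝ} (hq : 0 ≤ q) (hq1 : q < 1) (hB : 0 ≤ B)
    (hK : 0 < 1 - K * c / (1 - q) ^ 2) (hc : 0 ≤ c) (hK0 : 0 ≤ K) (hδ : ∀ t, 0 ≤ δ t)
    (hδ0 : δ 0 = 0)
    (hrec : ∀ t, δ (t + 1) ≤ q * δ t + q ^ 2 / (1 - q) * c * (B + K * δ t)) (T : ℕ) :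
    ∑ t ∈ Finset.range T, δ t ≤ c * (T * B) * (1 - K * c / (1 - q) ^ 2)⁻¹ / (1 - q) ^ 2 := by
  set S := ∑ t ∈ Finset.range T, δ t with hS
  have hS0 : 0 ≤ S := Finset.sum_nonneg fun t _ => hδ t
  have hq' : 0 < 1 - q := by linarith
  -- The shift of the index is free: the dropped term `δ 0` is zero and the new term `δ T` is
  -- nonnegative.
  have h1 : S ≤ ∑ t ∈ Finset.range T, δ (t + 1) := by
    have h2 := Finset.sum_range_succ δ T
    have h3 := Finset.sum_range_succ' δ T
    have := hδ T
    linarith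
  have h2 := Finset.sum_le_sum fun t (_ : t ∈ Finset.range T) => hrec t
  rw [Finset.sum_add_distrib, ← Finset.mul_sum, ← Finset.mul_sum, Finset.sum_add_distrib,
    ← Finset.mul_sum, Finset.sum_const, Finset.card_range, nsmul_eq_mul, ← hS] at h2
  have h3 : (1 - q) * S ≤ q ^ 2 / (1 - q) * c * (T * B + K * S) := by linarith
  have hE : 0 ≤ c * (T * B + K * S) := by positivity
  have h4 : (1 - q) ^ 2 * S ≤ c * (T * B + K * S) := by
    have h5 := mul_le_mul_of_nonneg_left h3 hq'.le
    have h6 : (1 - q) * (q ^ 2 / (1 - q) * c * (T * B + K * S))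
        = q ^ 2 * (c * (T * B + K * S)) := by field_simp
    have h7 : q ^ 2 * (c * (T * B + K * S)) ≤ c * (T * B + K * S) :=
      mul_le_of_le_one_left hE (by nlinarith)
    calc _ = (1 - q) * ((1 - q) * S) := by ring
      _ ≤ _ := h5.trans (h6.trans_le h7)
  -- Absorption: the multiple of `S` on the right moves to the left, where its total coefficient is
  -- positive by `hK`.
  have hκ : S * (1 - q) ^ 2 * (1 - K * c / (1 - q) ^ 2) = S * (1 - q) ^ 2 - K * c * S := by
    field_simp
  rw [le_div_iff₀ (by positivity), ← div_eq_mul_inv, le_div_iff₀ hK, hκ]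
  linarith

/-- Summation of a descent recursion. -/
theorem average_le_of_descent {φ G δ : ℕ → ℝ} {γ a b l : ℝ} (hγ : 0 < γ)
    (hrec : ∀ t, φ (t + 1) ≤ φ t - γ / 2 * G t + a * δ t + b) (hl : ∀ t, l ≤ φ t) {T : ℕ}
    (hT : 0 < T) :
    (1 / (T : ℝ)) * ∑ t ∈ Finset.range T, G t ≤ 2 * (φ 0 - l) / (γ * T)
      + 2 * a / γ * ((∑ t ∈ Finset.range T, δ t) / T) + 2 * b / γ := by
  have hT' : (0 : ℝ) < T := by exact_mod_cast hT
  have h1 : ∑ t ∈ Finset.range T, (φ (t + 1) - φ t)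
      ≤ ∑ t ∈ Finset.range T, (-(γ / 2) * G t + a * δ t + b) :=
    Finset.sum_le_sum fun t _ => by linarith [hrec t]
  rw [Finset.sum_range_sub, Finset.sum_add_distrib, Finset.sum_add_distrib, ← Finset.mul_sum,
    ← Finset.mul_sum, Finset.sum_const, Finset.card_range, nsmul_eq_mul] at h1
  have h2 := hl T
  set A := ∑ t ∈ Finset.range T, G t
  set S := ∑ t ∈ Finset.range T, δ t
  have h3 : γ / 2 * A ≤ (φ 0 - l) + a * S + T * b := by linarith
  have h4 : 2 * (φ 0 - l) / (γ * T) + 2 * a / γ * (S / T) + 2 * b / γ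
      = 2 / (γ * T) * ((φ 0 - l) + a * S + T * b) := by field_simp
  have h5 : 1 / (T : ℝ) * A = 2 / (γ * T) * (γ / 2 * A) := by field_simp
  rw [h4, h5]
  gcongr

end RPS

end

/-! ### Assembly of the convergence bound -/

theorem theorem1
    -- `n` workers, blocks of size `m`, drop probability `p`
    {n m : ℕ} (hn : 0 < n) (p : unitInterval) (hp : (p : ℝ) < 1)
    -- data distributions and loss functions
    {Ξ : Fin n → Type*} [∀ i, MeasurableSpace (Ξ i)]
    (D : ∀ i, Measure (Ξ i)) [∀ i, IsProbabilityMeasure (D i)]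
    (F : ∀ i, RPS.Model n m → Ξ i → ℝ)
    (hFmeas : ∀ i, Measurable (Function.uncurry (F i)))
    (hFint : ∀ i x, Integrable (F i x) (D i))
    (hFdiff : ∀ i ξ, Differentiable ℝ (fun x => F i x ξ))
    (hfdiff : ∀ i, Differentiable ℝ (RPS.localLoss D F i))
    (hfbdd : BddBelow (Set.range (RPS.globalLoss D F)))
    -- Lipschitz gradients
    (L : ℝ) (hL : 0 ≤ L)
    (hLip : ∀ i x y, ‖gradient (RPS.localLoss D F i) x - gradient (RPS.localLoss D F i) y‖
      ≤ L * ‖x - y‖)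
    -- bounded variance
    (σ ζ : ℝ)
    (hσ : ∀ i x,
      Integrable (fun ξ => ‖RPS.stochGradient F i x ξ - gradient (RPS.localLoss D F i) x‖ ^ 2)
        (D i) ∧
      ∫ ξ, ‖RPS.stochGradient F i x ξ - gradient (RPS.localLoss D F i) x‖ ^ 2 ∂(D i) ≤ σ ^ 2)
    (hζ : ∀ x, (1 / (n : ℝ)) *
      ∑ i, ‖gradient (RPS.localLoss D F i) x - gradient (RPS.globalLoss D F) x‖ ^ 2 ≤ ζ ^ 2)
    -- the randomness of the iterations
    {Ω : Type*} [MeasurableSpace Ω] (P : Measure Ω) [IsProbabilityMeasure P]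
    (Y : ℕ → Ω → (∀ i, Ξ i) × RPS.Net n)
    (hY : RPS.IsIIDSample P (RPS.roundLaw D p) Y) :
    (∃ α₁ α₂ : ℝ, RPS.IsMixingPair n p α₁ α₂) ∧
    ∀ α₁ α₂ : ℝ, RPS.IsMixingPair n p α₁ α₂ →
    ∀ β : ℝ, β = α₁ - α₂ →
    ∀ γ : ℝ, 0 < γ → 0 < 1 - 6 * L ^ 2 * γ ^ 2 / (1 - √β) ^ 2 →
    ∀ C₁ : ℝ, C₁ = (1 - 6 * L ^ 2 * γ ^ 2 / (1 - √β) ^ 2)⁻¹ →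
    ∀ X : ℕ → Ω → Fin n → RPS.Model n m,
      (∀ t ω, X t ω = RPS.iterate F γ (fun r => Y r ω) t) →
    ∀ T : ℕ, 0 < T →
      (∀ t < T,
        Integrable (fun ω => ‖gradient (RPS.globalLoss D F) (RPS.average (X t ω))‖ ^ 2) P ∧
        Integrable (fun ω => ‖RPS.averageGradient D F (X t ω)‖ ^ 2) P) ∧
      (1 / (T : ℝ)) * ∑ t ∈ Finset.range T,
          ((∫ ω, ‖gradient (RPS.globalLoss D F) (RPS.average (X t ω))‖ ^ 2 ∂P)
            + (1 - L * γ) * ∫ ω, ‖RPS.averageGradient D F (X t ω)‖ ^ 2 ∂P)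
        ≤ 2 * (RPS.globalLoss D F 0 - ⨅ x, RPS.globalLoss D F x) / (γ * T)
          + γ * L * σ ^ 2 / n
          + 4 * α₂ * L * γ * (σ ^ 2 + 3 * ζ ^ 2)
          + (2 * α₂ * L * γ + L ^ 2 * γ ^ 2 + 12 * α₂ * L ^ 3 * γ ^ 3) * σ ^ 2 * C₁
              / (1 - √β) ^ 2
          + 3 * (2 * α₂ * L * γ + L ^ 2 * γ ^ 2 + 12 * α₂ * L ^ 3 * γ ^ 3) * ζ ^ 2 * C₁
              / (1 - √β) ^ 2 := by
  have h : RPS.IsRegularLoss D F L σ ζ :=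
    ⟨hFmeas, hFint, hFdiff, hfdiff, hL, hLip, hσ, hζ⟩
  refine ⟨RPS.exists_isMixingPair hn hp, ?_⟩
  intro α₁ α₂ hα β hβ γ hγ hC C₁ hC₁ X hX T hT
  have hXeq : X = fun t ω => RPS.iterate F γ (fun r => Y r ω) t := funext₂ hX
  subst hXeq
  have hmem := h.memLp_iterate hY γ
  refine ⟨fun t _ => ⟨h.integrable_norm_sq_gradient (hmem t),
    h.integrable_norm_sq_averageGradient (hmem t)⟩, ?_⟩
  have hβ0 : 0 ≤ β := by linarith [hα.le]
  have hβ1 : β < 1 := by linarith [hα.lt_one, hα.nonneg]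
  have hn' : (0 : ℝ) < n := by exact_mod_cast hn
  have hT' : (0 : ℝ) < T := by exact_mod_cast hT
  have hα0 := hα.nonneg
  set q := √β with hqdef
  have hq : 0 ≤ q := Real.sqrt_nonneg β
  have hq1 : q < 1 := by
    rw [hqdef, Real.sqrt_lt' one_pos, one_pow]
    exact hβ1
  have hq' : 0 < 1 - q := by linarith
  have hqα : q ^ 2 = α₁ - α₂ := by rw [hqdef, Real.sq_sqrt hβ0, hβ]
  have hpos : 0 ≤ σ ^ 2 + 3 * ζ ^ 2 := by positivity
  have hsum := RPS.sum_le_of_contraction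
    (δ := fun t => ∫ ω, RPS.deviation (RPS.iterate F γ (fun r => Y r ω) t) ∂P)
    (c := γ ^ 2) (B := n * (σ ^ 2 + 3 * ζ ^ 2)) (K := 6 * L ^ 2) hq hq1 (by positivity) hC
    (by positivity) (by positivity) (fun t => integral_nonneg fun ω => RPS.deviation_nonneg _)
    (by simp [RPS.iterate, RPS.deviation, RPS.average])
    (fun t => h.integral_deviation_iterate_succ_le hY hα γ hq hq1 hqα t) T
  have hlow : ∀ t, ⨅ x, RPS.globalLoss D F x
      ≤ ∫ ω, RPS.globalLoss D F (RPS.average (RPS.iterate F γ (fun r => Y r ω) t)) ∂P := fun t => by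
    have := integral_mono (integrable_const (μ := P) (⨅ x, RPS.globalLoss D F x))
      (h.integrable_globalLoss hfbdd (RPS.memLp_average (hmem t))) fun ω => ciInf_le hfbdd _
    simpa using this
  have hdesc := RPS.average_le_of_descent
    (φ := fun t =>
      ∫ ω, RPS.globalLoss D F (RPS.average (RPS.iterate F γ (fun r => Y r ω) t)) ∂P)
    (G := fun t => (∫ ω, ‖gradient (RPS.globalLoss D F)
        (RPS.average (RPS.iterate F γ (fun r => Y r ω) t))‖ ^ 2 ∂P)
      + (1 - L * γ) * ∫ ω, ‖RPS.averageGradient D F (RPS.iterate F γ (fun r => Y r ω) t)‖ ^ 2 ∂P)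
    (δ := fun t => ∫ ω, RPS.deviation (RPS.iterate F γ (fun r => Y r ω) t) ∂P)
    (a := γ / 2 * (L ^ 2 / n) + L * α₂ / n * (1 + 6 * L ^ 2 * γ ^ 2))
    (b := L / 2 * (γ ^ 2 * (σ ^ 2 / n)) + L * α₂ * γ ^ 2 * (σ ^ 2 + 3 * ζ ^ 2)) hγ
    (fun t => by
      refine (h.integral_globalLoss_iterate_succ_le hfbdd hY hα hn hγ t).trans_eq ?_
      field_simp
      ring) hlow hT
  refine hdesc.trans ?_
  rw [← hC₁] at hsum
  set S := ∑ t ∈ Finset.range T,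
    ∫ ω, RPS.deviation (RPS.iterate F γ (fun r => Y r ω) t) ∂P
  have hφ0 : ∫ ω, RPS.globalLoss D F (RPS.average (RPS.iterate F γ (fun r => Y r ω) 0)) ∂P
      = RPS.globalLoss D F 0 := by
    simp [RPS.iterate, RPS.average]
  rw [hφ0]
  have hST : S / T ≤ n * (γ ^ 2 * (σ ^ 2 + 3 * ζ ^ 2) * C₁ / (1 - q) ^ 2) := by
    rw [div_le_iff₀ hT']
    refine hsum.trans_eq ?_
    ring
  have ha : 0 ≤ 2 * (γ / 2 * (L ^ 2 / n) + L * α₂ / n * (1 + 6 * L ^ 2 * γ ^ 2)) / γ := by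
    positivity
  have hmain := mul_le_mul_of_nonneg_left hST ha
  have hval : 2 * (γ / 2 * (L ^ 2 / n) + L * α₂ / n * (1 + 6 * L ^ 2 * γ ^ 2)) / γ
        * (n * (γ ^ 2 * (σ ^ 2 + 3 * ζ ^ 2) * C₁ / (1 - q) ^ 2))
      = (2 * α₂ * L * γ + L ^ 2 * γ ^ 2 + 12 * α₂ * L ^ 3 * γ ^ 3) * σ ^ 2 * C₁ / (1 - q) ^ 2
        + 3 * (2 * α₂ * L * γ + L ^ 2 * γ ^ 2 + 12 * α₂ * L ^ 3 * γ ^ 3) * ζ ^ 2 * C₁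
          / (1 - q) ^ 2 := by
    field_simp
    ring
  have hb : 2 * (L / 2 * (γ ^ 2 * (σ ^ 2 / n)) + L * α₂ * γ ^ 2 * (σ ^ 2 + 3 * ζ ^ 2)) / γ
      = γ * L * σ ^ 2 / n + 2 * α₂ * L * γ * (σ ^ 2 + 3 * ζ ^ 2) := by
    field_simp
  -- The argument produces the coefficient `2` where the theorem has `4`; this nonnegative term
  -- covers the difference.
  have hslack : 0 ≤ α₂ * L * γ * (σ ^ 2 + 3 * ζ ^ 2) := by positivity
  rw [hval] at hmain
  rw [hb]
  linarith
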